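/- Let $\mathcal D(x)=\begin{pmatrix}a&b\\ c&d\end{pmatrix}$ be a $2\times2$ matrix of complex rational functions with $\operatorname{Tr}\mathcal D=a+d=0$. Let $U\subset\mathbb C$ be open and contain no pole of $\mathcal D$, and let $\Psi=\begin{pmatrix}\psi&\phi\\ \tilde\psi&\tilde\phi\end{pmatrix}$ be a holomorphic matrix function on $U$ with $\Psi'=\mathcal D\Psi$ and $\det\Psi=1$. For $x_1\ne x_2$ in $U$ let $$K(x_1,x_2)=\frac{\psi(x_1)\tilde\phi(x_2)-\tilde\psi(x_1)\phi(x_2)}{x_1-x_2}$$ be the Christoffel–Darboux kernel. Define $W_1(x)=\lim_{x'\to x}\big(K(x,x')-\frac1{x-x'}\big)$ (this limit exists for every $x\in U$) and, for $k\ge2$ and pairwise distinct $x_1,\dots,x_k\in U$, $$W_k(x_1,\dots,x_k)=-\frac{\delta_{k,2}}{(x_1-x_2)^2}-(-1)^k\sum_{\sigma}\prod_{i=1}^kK(x_i,x_{\sigma(i)}),$$ where $\sigma$ runs over the permutations of $\{1,\dots,k\}$ that are a single cycle of length $k$. Let $$M(x)=\begin{pmatrix}\phi(x)\\ \tilde\phi(x)\end{pmatrix}\begin{pmatrix}\psi(x)&\tilde\psi(x)\end{pmatrix}\begin{pmatrix}0&1\\-1&0\end{pmatrix}.$$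 Define rational functions of $x$ by $$P_1(x)=\det\mathcal D(x),\qquad P_2(x;x_1)=\frac{\operatorname{Tr}\big[\big(\mathcal D(x)-\mathcal D(x_1)-(x-x_1)\mathcal D'(x_1)\big)M(x_1)\big]}{(x-x_1)^2},$$ and for $n\ge2$ $$P_{n+1}(x;x_1,\dots,x_n)=(-1)^n\Big[Q_{n+1}(x;x_1,\dots,x_n)-\sum_{j=1}^n\frac1{x-x_j}\operatorname*{Res}_{x'\to x_j}Q_{n+1}(x';x_1,\dots,x_n)\Big],$$ $$Q_{n+1}(x;x_1,\dots,x_n)=\sum_{\sigma\in S_n}\frac{\operatorname{Tr}\mathcal D(x)M(x_{\sigma(1)})\cdots M(x_{\sigma(n)})}{(x-x_{\sigma(1)})(x_{\sigma(1)}-x_{\sigma(2)})\cdots(x_{\sigma(n-1)}-x_{\sigma(n)})(x_{\sigma(n)}-x)}.$$ Theorem. Let $n\ge0$ and let $L=(x_1,\dots,x_n)$ be pairwise distinct points of $U$. Then the rational function $x\mapsto P_{n+1}(x;L)$ has no poles on the Riemann sphere other than poles of entries of $\mathcal D$. For every $x\in U\setminus\{x_1,\dots,x_n\}$, the limit $$W_{n+2}(x,x,L):=\lim_{x'\to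 x}W_{n+2}(x,x',L)$$ and the derivatives below exist, and the loop equation $$-P_{n+1}(x;L)=W_{n+2}(x,x,L)+\sum_{J\subseteq L}W_{1+|J|}(x,J)\,W_{1+n-|J|}(x,L\setminus J)+\sum_{j=1}^n\frac{\partial}{\partial x_j}\,\frac{W_n(x,L\setminus\{x_j\})-W_n(L)}{x-x_j}$$ holds, where $J$ runs over all subsets of $L$, including $\emptyset$ and $L$. -/

import Mathlib

open Filter Topology

noncomputable section

namespace LoopEq

/-- The value of a rational function at a complex number (used only away from its poles). -/
def evalAt (f : RatFunc ℂ) (z : ℂ) : ℂ :=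
  RatFunc.eval (RingHom.id ℂ) z f

/-- `p` is a pole of the rational function `f` on the Riemann sphere. -/
def IsPole (f : RatFunc ℂ) : OnePoint ℂ → Prop
  | none => 0 < f.intDegree
  | some z => f.denom.eval z = 0

/-- The residue of a rational function at the finite point `z`: the coefficient of `T⁻¹` in the
Laurent expansion of `f (z + T)` at `T = 0`. -/
def residue (f : RatFunc ℂ) (z : ℂ) : ℂ :=
  ((RatFunc.laurent z f : RatFunc ℂ) : LaurentSeries ℂ).coeff (-1)

/-- The matrix `𝒟(z)`. -/
def evalMat (D : Matrix (Fin 2) (Fin 2) (RatFunc ℂ)) (z : ℂ) : Matrix (Fin 2) (Fin 2) ℂ :=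
  D.map fun f => evalAt f z

/-- The derivative `𝒟'(z)`, entry by entry. -/
def derivMat (D : Matrix (Fin 2) (Fin 2) (RatFunc ℂ)) (z : ℂ) : Matrix (Fin 2) (Fin 2) ℂ :=
  D.map fun f => deriv (evalAt f) z

/-- A matrix of complex numbers, seen as a matrix of constant rational functions. -/
def constMat (m : Matrix (Fin 2) (Fin 2) ℂ) : Matrix (Fin 2) (Fin 2) (RatFunc ℂ) :=
  m.map RatFunc.C

/-- The Christoffel-Darboux kernel. With `Ψ = !![ψ, φ; ψt, φt]` it is
`(ψ(x₁) φt(x₂) - ψt(x₁) φ(x₂)) / (x₁ - x₂)`. -/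
def K (Ψ : ℂ → Matrix (Fin 2) (Fin 2) ℂ) (x₁ x₂ : ℂ) : ℂ :=
  (Ψ x₁ 0 0 * Ψ x₂ 1 1 - Ψ x₁ 1 0 * Ψ x₂ 0 1) / (x₁ - x₂)

open Classical in
/-- The connected correlation function `W_n` (for `n ≥ 2` at pairwise distinct points). For
`n ≥ 2` the sum is over the permutations of the `n` indices that consist of one cycle of
length `n`. The value for `n = 0` is a placeholder that is not used. -/
def W (Ψ : ℂ → Matrix (Fin 2) (Fin 2) ℂ) : (n : ℕ) → (Fin n → ℂ) → ℂ
  | 0, _ => 0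
  | 1, x => limUnder (𝓝[≠] (x 0)) fun x' => K Ψ (x 0) x' - 1 / (x 0 - x')
  | n + 2, x =>
      -(if n = 0 then 1 / (x 0 - x 1) ^ 2 else 0)
        - (-1) ^ (n + 2) *
          ∑ σ : Equiv.Perm (Fin (n + 2)) with σ.IsCycle ∧ σ.support = Finset.univ,
            ∏ i, K Ψ (x i) (x (σ i))

/-- The tuple `(x, J)`: the point `x` followed by the points `xs j`, `j ∈ J`, in increasing order
of the index `j`. -/
def withPoint {n : ℕ} (x : ℂ) (xs : Fin n → ℂ) (J : Finset (Fin n)) : Fin (J.card + 1) → ℂ :=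
  Fin.cons x fun i => xs (J.orderEmbOfFin rfl i)

/-- The rank one matrix `M(x)`: the column `(φ, φt)` times the row `(ψ, ψt)` times
`A = !![0, 1; -1, 0]`. -/
def M (Ψ : ℂ → Matrix (Fin 2) (Fin 2) ℂ) (x : ℂ) : Matrix (Fin 2) (Fin 2) ℂ :=
  Matrix.vecMulVec (fun i => Ψ x i 1) (fun i => Ψ x i 0) * !![0, 1; -1, 0]

/-- `Q_{m+1}(x; x_1, …, x_m)` for `m = n + 2 ≥ 2`, as a rational function of `x`. -/
def Q (D : Matrix (Fin 2) (Fin 2) (RatFunc ℂ)) (Ψ : ℂ → Matrix (Fin 2) (Fin 2) ℂ)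
    {n : ℕ} (xs : Fin (n + 2) → ℂ) : RatFunc ℂ :=
  ∑ σ : Equiv.Perm (Fin (n + 2)),
    (D * constMat (List.ofFn fun i => M Ψ (xs (σ i))).prod).trace /
      ((RatFunc.X - RatFunc.C (xs (σ 0))) *
        RatFunc.C (∏ i : Fin (n + 1), (xs (σ i.castSucc) - xs (σ i.succ))) *
        (RatFunc.C (xs (σ (Fin.last (n + 1)))) - RatFunc.X))

/-- `P_{n+1}(x; x_1, …, x_n)`, as a rational function of `x`. -/
def P (D : Matrix (Fin 2) (Fin 2) (RatFunc ℂ)) (Ψ : ℂ → Matrix (Fin 2) (Fin 2) ℂ) :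
    (n : ℕ) → (Fin n → ℂ) → RatFunc ℂ
  | 0, _ => D.det
  | 1, xs =>
      ((D - constMat (evalMat D (xs 0))
          - (RatFunc.X - RatFunc.C (xs 0)) • constMat (derivMat D (xs 0)))
        * constMat (M Ψ (xs 0))).trace / (RatFunc.X - RatFunc.C (xs 0)) ^ 2
  | n + 2, xs =>
      (-1) ^ (n + 2) *
        (Q D Ψ xs - ∑ j, 1 / (RatFunc.X - RatFunc.C (xs j)) *
          RatFunc.C (residue (Q D Ψ xs) (xs j)))

end LoopEq

end

/-! Write M for `M Ψ`. As det Ψ = 1, each M(x) is a rank one projector of trace 1, and as 𝒟 is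
traceless, M' = [𝒟, M]. Rank one makes a product of kernels along a path equal to a product of
inverse differences times the trace of a word in M (`path_K_eq`). A full cycle can be cut open at
any of its points (`sum_full_cycles`), so every W_k becomes a sum over orderings of the other points
of rational weights (`chain`) times traces of words.

Let S be the set of points of L, and let G_J = `matSum` and g_J = `chainSum` be the weighted sums
over loops from x through J. For S nonempty, W_{n+2}(x,t,L) is, up to sign, the sum over J ⊆ S of
(paths x → t through J) · (paths t → x through S \ J). Only J = ∅ and J = S are singular at t = x.
Their poles combine into a difference quotient, so the limit consists of products of W's and one
derivative (`hasDerivAt_pathSum_sub`). The polarized Cayley-Hamilton identity evaluates that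
derivative; besides correlation functions the limit contains tr 𝒟(x)G_S(x) and T = ½ ∑_J (tr G_J
G_{S∖J} − g_J g_{S∖J}) (`tendsto_sum_pathSum_mul_pathSum`).

For at least two points, two identities conclude. Partial fractions in x turn G_S(x) into the sum of
[M(x_j), G_{S∖x_j}(x_j)]/(x − x_j) (`matSum_eq_sum_commutator`). P is, up to sign, the corresponding
sum of difference quotients of tr 𝒟(x)[M(x_j), G_{S∖x_j}(x_j)] at x_j (`P_add_two_eq`), hence has no
new poles; the values subtracted at x_j are what M' = [𝒟, M] contributes to ∂W_n/∂x_j. The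
derivatives of the weights, together with W_n(L)/(x − x_j)², cancel T (`sum_trace_cyclicChain`). For
n = 1 the same limit is evaluated directly; n = 0 is a second order expansion of tr M(t)M(x). -/

namespace LoopEq

/-! ### Sums over the orderings of a finite set. -/

section Orderings

variable {α β : Type*} [DecidableEq α] [DecidableEq β]

/-- The orderings of a finite set: the lists without repetition whose set of entries is `S`. -/
def orderings (S : Finset α) : Finset (List α) :=
  ⟨S.val.lists, Multiset.lists_nodup_finset S⟩

theorem mem_orderings {S : Finset α} {l : List α} :
    l ∈ orderings S ↔ l.Nodup ∧ l.toFinset = S := by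
  rw [orderings, Finset.mem_mk, Multiset.mem_lists_iff]
  constructor
  · intro h
    have hn : l.Nodup := by
      have := S.nodup
      rw [h] at this
      exact Multiset.coe_nodup.1 this
    refine ⟨hn, ?_⟩
    rw [← Finset.val_inj, List.toFinset_val, hn.dedup, h]
    rfl
  · rintro ⟨hn, rfl⟩
    rw [List.toFinset_val, hn.dedup]
    rfl

theorem orderings_empty : orderings (∅ : Finset α) = {[]} := by
  ext l
  rw [mem_orderings, Finset.mem_singleton, List.toFinset_eq_empty_iff]
  constructor
  · exact fun h => h.2
  · rintro rfl
    exact ⟨List.nodup_nil, rfl⟩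

theorem mem_of_mem_orderings {S : Finset α} {l : List α} (hl : l ∈ orderings S) {a : α} :
    a ∈ l ↔ a ∈ S := by
  rw [← (mem_orderings.1 hl).2, List.mem_toFinset]

theorem length_of_mem_orderings {S : Finset α} {l : List α} (hl : l ∈ orderings S) :
    l.length = S.card := by
  obtain ⟨hn, rfl⟩ := mem_orderings.1 hl
  exact (List.toFinset_card_of_nodup hn).symm

theorem ne_nil_of_mem_orderings {S : Finset α} (hS : S.Nonempty) {l : List α}
    (hl : l ∈ orderings S) : l ≠ [] := by
  rintro rfl
  have := length_of_mem_orderings hl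
  exact hS.card_pos.ne this

theorem cons_mem_orderings {S : Finset α} {a : α} {l : List α} :
    a :: l ∈ orderings S ↔ a ∈ S ∧ l ∈ orderings (S.erase a) := by
  simp only [mem_orderings, List.nodup_cons, List.toFinset_cons]
  constructor
  · rintro ⟨⟨ha, hn⟩, rfl⟩
    exact ⟨Finset.mem_insert_self _ _, hn, by
      rw [Finset.erase_insert (by simpa using ha)]⟩
  · rintro ⟨ha, hn, h⟩
    refine ⟨⟨?_, hn⟩, by rw [h, Finset.insert_erase ha]⟩
    rw [← List.mem_toFinset, h]
    exact Finset.notMem_erase _ _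

theorem concat_mem_orderings {S : Finset α} {a : α} {l : List α} :
    l ++ [a] ∈ orderings S ↔ a ∈ S ∧ l ∈ orderings (S.erase a) := by
  rw [← cons_mem_orderings, mem_orderings, mem_orderings]
  have hp : (l ++ [a]).Perm (a :: l) := List.perm_append_singleton a l
  rw [hp.nodup_iff, List.toFinset_eq_of_perm _ _ hp]

variable {V : Type*} [AddCommMonoid V]

theorem sum_orderings_cons {S : Finset α} (hS : S.Nonempty) (f : List α → V) :
    ∑ l ∈ orderings S, f l = ∑ a ∈ S, ∑ l ∈ orderings (S.erase a), f (a :: l) := by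
  rw [Finset.sum_sigma']
  symm
  refine Finset.sum_bij (fun p _ => p.1 :: p.2) ?_ ?_ ?_ ?_
  · rintro ⟨a, l⟩ h
    exact cons_mem_orderings.2 (Finset.mem_sigma.1 h)
  · rintro ⟨a, l⟩ _ ⟨b, m⟩ _ h
    simp only [List.cons.injEq] at h
    obtain ⟨rfl, rfl⟩ := h
    rfl
  · rintro l hl
    cases l with
    | nil => exact absurd rfl (ne_nil_of_mem_orderings hS hl)
    | cons a l => exact ⟨⟨a, l⟩, Finset.mem_sigma.2 (cons_mem_orderings.1 hl), rfl⟩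
  · rintro ⟨a, l⟩ _
    rfl

theorem sum_orderings_concat {S : Finset α} (hS : S.Nonempty) (f : List α → V) :
    ∑ l ∈ orderings S, f l = ∑ a ∈ S, ∑ l ∈ orderings (S.erase a), f (l ++ [a]) := by
  rw [Finset.sum_sigma']
  symm
  refine Finset.sum_bij (fun p _ => p.2 ++ [p.1]) ?_ ?_ ?_ ?_
  · rintro ⟨a, l⟩ h
    exact concat_mem_orderings.2 (Finset.mem_sigma.1 h)
  · rintro ⟨a, l⟩ _ ⟨b, m⟩ _ h
    obtain ⟨h1, h2⟩ := List.append_inj' h rfl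
    simp only [List.cons.injEq, and_true] at h1 h2
    subst h1 h2
    rfl
  · rintro l hl
    obtain rfl | ⟨m, a, rfl⟩ := List.eq_nil_or_concat' l
    · exact absurd rfl (ne_nil_of_mem_orderings hS hl)
    · exact ⟨⟨a, m⟩, Finset.mem_sigma.2 (concat_mem_orderings.1 hl), rfl⟩
  · rintro ⟨a, l⟩ _
    rfl

theorem append_mem_orderings {S : Finset α} {l₁ l₂ : List α} :
    l₁ ++ l₂ ∈ orderings S ↔
      l₁.toFinset ∈ S.powerset ∧ l₁ ∈ orderings l₁.toFinset ∧
        l₂ ∈ orderings (S \ l₁.toFinset) := by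
  simp only [mem_orderings, List.nodup_append', List.toFinset_append, Finset.mem_powerset,
    and_true]
  constructor
  · rintro ⟨⟨h1, h2, h3⟩, rfl⟩
    refine ⟨Finset.subset_union_left, h1, h2, ?_⟩
    rw [Finset.union_sdiff_left, Finset.sdiff_eq_self_of_disjoint]
    rw [Finset.disjoint_left]
    intro a ha ha'
    exact h3 (List.mem_toFinset.1 ha') (List.mem_toFinset.1 ha)
  · rintro ⟨hs, h1, h2, h3⟩
    refine ⟨⟨h1, h2, fun a ha ha' => ?_⟩, ?_⟩
    · rw [← List.mem_toFinset, h3] at ha'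
      exact (Finset.mem_sdiff.1 ha').2 (List.mem_toFinset.2 ha)
    · rw [h3, Finset.union_sdiff_of_subset hs]

/-- Concatenation is a bijection from pairs of orderings of J and S \ J to orderings of S with a
marked cut position. -/
theorem sum_orderings_split (S : Finset α) (f : List α → List α → V) :
    ∑ J ∈ S.powerset, ∑ l₁ ∈ orderings J, ∑ l₂ ∈ orderings (S \ J), f l₁ l₂ =
      ∑ l ∈ orderings S, ∑ k ∈ Finset.range (S.card + 1), f (l.take k) (l.drop k) := by
  simp_rw [Finset.sum_sigma']
  refine Finset.sum_bij (fun p _ => ⟨p.2.1 ++ p.2.2, p.2.1.length⟩) ?_ ?_ ?_ ?_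
  · rintro ⟨J, l₁, l₂⟩ h
    simp only [Finset.mem_sigma] at h ⊢
    obtain ⟨hJ, h1, h2⟩ := h
    obtain ⟨hn, rfl⟩ := mem_orderings.1 h1
    have h := append_mem_orderings.2 ⟨hJ, h1, h2⟩
    refine ⟨h, ?_⟩
    have hl := length_of_mem_orderings h
    rw [List.length_append] at hl
    rw [Finset.mem_range]
    omega
  · rintro ⟨J, l₁, l₂⟩ h ⟨J', m₁, m₂⟩ h' he
    simp only [Finset.mem_sigma] at h h'
    simp only [Sigma.mk.injEq, heq_eq_eq] at he
    obtain ⟨e1, e2⟩ := List.append_inj he.1 he.2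
    subst e1 e2
    obtain rfl := (mem_orderings.1 h.2.1).2
    obtain rfl := (mem_orderings.1 h'.2.1).2
    rfl
  · rintro ⟨l, k⟩ h
    simp only [Finset.mem_sigma, Finset.mem_range] at h
    have hl := length_of_mem_orderings h.1
    refine ⟨⟨(l.take k).toFinset, l.take k, l.drop k⟩, ?_, ?_⟩
    · simp only [Finset.mem_sigma]
      exact append_mem_orderings.1 (by rw [List.take_append_drop]; exact h.1)
    · simp only [List.take_append_drop, Sigma.mk.injEq, heq_eq_eq, true_and, List.length_take]
      omega
  · rintro ⟨J, l₁, l₂⟩ _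
    simp

/-- An ordering splits uniquely at the letter y. This breaks a loop from x through x' into a path x
→ x' and a path x' → x. -/
theorem sum_orderings_insert {S : Finset α} {y : α} (hy : y ∉ S) (f : List α → V) :
    ∑ l ∈ orderings (insert y S), f l =
      ∑ J ∈ S.powerset, ∑ l₁ ∈ orderings J, ∑ l₂ ∈ orderings (S \ J), f (l₁ ++ y :: l₂) := by
  simp_rw [Finset.sum_sigma']
  symm
  refine Finset.sum_bij (fun p _ => p.2.1 ++ y :: p.2.2) ?_ ?_ ?_ ?_
  · rintro ⟨J, l₁, l₂⟩ h
    simp only [Finset.mem_sigma] at h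
    obtain ⟨hJ, h1, h2⟩ := h
    have hp : (l₁ ++ y :: l₂).Perm (y :: (l₁ ++ l₂)) := List.perm_middle
    obtain ⟨hn, rfl⟩ := mem_orderings.1 h1
    have h := append_mem_orderings.2 ⟨hJ, h1, h2⟩
    have h' : y :: (l₁ ++ l₂) ∈ orderings (insert y S) :=
      cons_mem_orderings.2 ⟨Finset.mem_insert_self _ _, by rwa [Finset.erase_insert hy]⟩
    rw [mem_orderings] at h' ⊢
    rwa [hp.nodup_iff, List.toFinset_eq_of_perm _ _ hp]
  · rintro ⟨J, l₁, l₂⟩ h ⟨J', m₁, m₂⟩ h' he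
    simp only [Finset.mem_sigma] at h h'
    have hy1 : y ∉ l₁ := fun hh =>
      hy (Finset.mem_powerset.1 h.1 ((mem_of_mem_orderings h.2.1).1 hh))
    have hy2 : y ∉ l₂ := fun hh =>
      hy (Finset.sdiff_subset ((mem_of_mem_orderings h.2.2).1 hh))
    simp only at he
    obtain ⟨e1, -, e2⟩ := (List.append_cons_inj_of_notMem hy1 hy2).1 he
    subst e1 e2
    obtain rfl := (mem_orderings.1 h.2.1).2
    obtain rfl := (mem_orderings.1 h'.2.1).2
    rfl
  · intro l hl
    obtain ⟨l₁, l₂, rfl⟩ := List.append_of_mem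
      ((mem_of_mem_orderings hl).2 (Finset.mem_insert_self y S))
    have hp : (l₁ ++ y :: l₂).Perm (y :: (l₁ ++ l₂)) := List.perm_middle
    rw [mem_orderings, hp.nodup_iff, List.toFinset_eq_of_perm _ _ hp, ← mem_orderings,
      cons_mem_orderings, Finset.erase_insert hy, append_mem_orderings] at hl
    exact ⟨⟨l₁.toFinset, l₁, l₂⟩, by simpa only [Finset.mem_sigma] using hl.2, rfl⟩
  · rintro ⟨J, l₁, l₂⟩ _
    rfl

theorem sum_orderings_image {g : α → β} (hg : Function.Injective g) (S : Finset α)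
    (f : List β → V) :
    ∑ l ∈ orderings (S.image g), f l = ∑ l ∈ orderings S, f (l.map g) := by
  symm
  refine Finset.sum_bij (fun l _ => l.map g) ?_ ?_ ?_ (fun _ _ => rfl)
  · intro l hl
    obtain ⟨hn, rfl⟩ := mem_orderings.1 hl
    exact mem_orderings.2 ⟨hn.map hg, by ext; simp⟩
  · intro l _ m _ h
    exact List.map_injective_iff.2 hg h
  · intro l hl
    obtain ⟨hn, hs⟩ := mem_orderings.1 hl
    have : ∀ a ∈ l, a ∈ Set.range g := by
      intro a ha
      rw [← List.mem_toFinset, hs, Finset.mem_image] at ha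
      obtain ⟨b, -, rfl⟩ := ha
      exact ⟨b, rfl⟩
    obtain ⟨m, rfl⟩ := (Set.mem_range (f := List.map g)).1
      (by rw [Set.range_list_map]; exact this)
    refine ⟨m, mem_orderings.2 ⟨List.Nodup.of_map g hn, ?_⟩, rfl⟩
    apply Finset.image_injective hg
    rw [← hs]
    ext
    simp

theorem sum_perm_eq_sum_orderings {n : ℕ} {g : Fin n → α} (hg : Function.Injective g)
    (f : List α → V) :
    ∑ σ : Equiv.Perm (Fin n), f (List.ofFn fun i => g (σ i)) =
      ∑ l ∈ orderings (Finset.univ.image g), f l := by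
  refine Finset.sum_bij (fun σ _ => List.ofFn fun i => g (σ i)) ?_ ?_ ?_ (fun _ _ => rfl)
  · intro σ _
    refine mem_orderings.2 ⟨List.nodup_ofFn.2 (hg.comp σ.injective), ?_⟩
    ext a
    simp only [List.mem_toFinset, List.mem_ofFn, Finset.mem_image, Finset.mem_univ, true_and]
    constructor
    · rintro ⟨i, rfl⟩
      exact ⟨σ i, rfl⟩
    · rintro ⟨i, rfl⟩
      exact ⟨σ.symm i, by simp⟩
  · intro σ _ τ _ h
    ext1 i
    exact hg (congrFun (List.ofFn_injective h) i)
  · intro l hl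
    obtain ⟨hn, hs⟩ := mem_orderings.1 hl
    have hlen : l.length = n := by
      rw [length_of_mem_orderings hl, Finset.card_image_of_injective _ hg, Finset.card_univ,
        Fintype.card_fin]
    subst hlen
    have : ∀ i : Fin l.length, ∃ j, g j = l.get i := by
      intro i
      have : l.get i ∈ l.toFinset := List.mem_toFinset.2 (List.get_mem l i)
      rw [hs, Finset.mem_image] at this
      obtain ⟨j, -, h⟩ := this
      exact ⟨j, h⟩
    choose s hs' using this
    have hinj : Function.Injective s := by
      intro i j h
      apply List.nodup_iff_injective_get.1 hn
      rw [← hs', ← hs', h]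
    refine ⟨Equiv.ofBijective s (Finite.injective_iff_bijective.1 hinj), Finset.mem_univ _, ?_⟩
    simp only [Equiv.ofBijective_apply, hs']
    exact List.ofFn_get l

end Orderings

/-! ### Products along paths and sums over full cycles. -/

section Path

variable {α β R : Type*} [CommMonoid R]

/-- The product of `k` along the consecutive pairs of the path from `y` through `l` to `z`. -/
def path (k : α → α → R) : α → List α → α → R
  | y, [], z => k y z
  | y, a :: l, z => k y a * path k a l z

theorem path_nil (k : α → α → R) (y z : α) : path k y [] z = k y z := rfl

theorem path_cons (k : α → α → R) (y a z : α) (l : List α) :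
    path k y (a :: l) z = k y a * path k a l z := rfl

theorem path_append_cons (k : α → α → R) (y a z : α) (l₁ l₂ : List α) :
    path k y (l₁ ++ a :: l₂) z = path k y l₁ a * path k a l₂ z := by
  induction l₁ generalizing y with
  | nil => rfl
  | cons b l ih => rw [List.cons_append, path_cons, path_cons, ih, mul_assoc]

theorem path_map (k : β → β → R) (g : α → β) (y z : α) (l : List α) :
    path k (g y) (l.map g) (g z) = path (fun a b => k (g a) (g b)) y l z := by
  induction l generalizing y with
  | nil => rfl
  | cons b l ih => rw [List.map_cons, path_cons, path_cons, ih]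

theorem prod_map_eq_path (k : α → α → R) (s : α → α) (y z : α) (l : List α)
    (h : ∀ i (hi : i < l.length), s ((y :: l)[i]'(by simp; omega)) = l[i])
    (hz : s ((y :: l)[l.length]'(by simp)) = z) :
    ((y :: l).map fun i => k i (s i)).prod = path k y l z := by
  induction l generalizing y with
  | nil => simp_all [path_nil]
  | cons a l ih =>
    rw [List.map_cons, List.prod_cons, path_cons, ih a]
    · congr 2
      exact h 0 (by simp)
    · intro i hi
      exact h (i + 1) (by simpa using hi)
    · exact hz

open Classical in
-- A full cycle is its itinerary started at j: `formPerm` and `toList` are inverse to each other.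
-- The free choice of j allows the cycle to be cut at whichever variable is being moved.
theorem sum_full_cycles {R : Type*} [CommSemiring R] [DecidableEq α] [Fintype α] [Nontrivial α]
    (k : α → α → R) (j : α) :
    ∑ σ : Equiv.Perm α with σ.IsCycle ∧ σ.support = Finset.univ, ∏ i, k i (σ i) =
      ∑ l ∈ orderings (Finset.univ.erase j), path k j l j := by
  have hord : ∀ {l : List α}, l ∈ orderings (Finset.univ.erase j) →
      (j :: l).Nodup ∧ (j :: l).toFinset = Finset.univ ∧ 2 ≤ (j :: l).length := by
    intro l hl
    have h := cons_mem_orderings.2 ⟨Finset.mem_univ j, hl⟩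
    obtain ⟨h1, h2⟩ := mem_orderings.1 h
    refine ⟨h1, h2, ?_⟩
    rw [length_of_mem_orderings h, Finset.card_univ]
    exact Fintype.one_lt_card
  symm
  refine Finset.sum_bij (fun l _ => (j :: l).formPerm) ?_ ?_ ?_ ?_
  · intro l hl
    obtain ⟨hn, hs, h2⟩ := hord hl
    rw [Finset.mem_filter]
    refine ⟨Finset.mem_univ _, List.isCycle_formPerm hn h2, ?_⟩
    convert List.support_formPerm_of_nodup _ hn ?_
    · exact hs.symm
    · intro x hx
      rw [hx] at h2
      simp at h2
  · intro l hl m hm h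
    obtain ⟨hn, hs, h2⟩ := hord hl
    obtain ⟨hn', hs', h2'⟩ := hord hm
    have e := Equiv.Perm.toList_formPerm_nontrivial _ h2 hn
    have e' := Equiv.Perm.toList_formPerm_nontrivial _ h2' hn'
    simp only [List.get_eq_getElem, List.getElem_cons_zero] at e e'
    rw [h, e'] at e
    simpa using e.symm
  · intro σ hσ
    obtain ⟨-, hc, hs⟩ := Finset.mem_filter.1 hσ
    have hj : j ∈ σ.support := by rw [hs]; exact Finset.mem_univ j
    have hne : σ.toList j ≠ [] := by
      rw [Ne, Equiv.Perm.toList_eq_nil_iff]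
      simpa using hj
    obtain ⟨a, l, hl⟩ := List.exists_cons_of_ne_nil hne
    have ha : a = j := by
      have := Equiv.Perm.toList_getElem_zero (p := σ) (x := j) hj
      simpa [hl] using this
    subst ha
    refine ⟨l, ?_, ?_⟩
    · refine ((cons_mem_orderings (a := a)).1 ?_).2
      rw [← hl, mem_orderings]
      refine ⟨Equiv.Perm.nodup_toList _ _, ?_⟩
      ext b
      simp only [List.mem_toFinset, Equiv.Perm.mem_toList_iff, Finset.mem_univ, iff_true]
      exact ⟨hc.sameCycle (Equiv.Perm.mem_support.1 hj)
        (Equiv.Perm.mem_support.1 (hs ▸ Finset.mem_univ b)), hj⟩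
    · rw [← hl, Equiv.Perm.formPerm_toList, hc.cycleOf_eq (Equiv.Perm.mem_support.1 hj)]
  · intro l hl
    obtain ⟨hn, hs, h2⟩ := hord hl
    rw [← hs, List.prod_toFinset _ hn]
    symm
    apply prod_map_eq_path
    · intro i hi
      rw [List.formPerm_apply_lt_getElem _ hn i (by simpa using hi)]
      simp
    · rw [List.formPerm_apply_getElem_length]

end Path

end LoopEq

/-! ### Partial fraction identities for products of inverse differences. -/

namespace LoopEq

/-- The product of the inverse differences of the consecutive points of the path `y, l, z`. It
vanishes for the trivial loop `x, x`. -/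
noncomputable def chain (y : ℂ) (l : List ℂ) (z : ℂ) : ℂ :=
  path (fun a b => (a - b)⁻¹) y l z

/-- The product of the inverse differences of the cyclically consecutive points of a list. -/
noncomputable def cyclicChain : List ℂ → ℂ
  | [] => 0
  | a :: l => chain a l a

theorem chain_nil (y z : ℂ) : chain y [] z = (y - z)⁻¹ := rfl

theorem chain_nil_self (y : ℂ) : chain y [] y = 0 := by simp [chain_nil]

theorem chain_cons (y a z : ℂ) (l : List ℂ) :
    chain y (a :: l) z = (y - a)⁻¹ * chain a l z := rfl

theorem chain_append_cons (y a z : ℂ) (l₁ l₂ : List ℂ) :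
    chain y (l₁ ++ a :: l₂) z = chain y l₁ a * chain a l₂ z :=
  path_append_cons _ _ _ _ _ _

theorem chain_concat (y a z : ℂ) (l : List ℂ) :
    chain y (l ++ [a]) z = chain y l a * (a - z)⁻¹ :=
  chain_append_cons _ _ _ _ _

theorem cyclicChain_concat (a : ℂ) (l : List ℂ) : cyclicChain (l ++ [a]) = chain a l a := by
  cases l with
  | nil => rfl
  | cons b l => rw [List.cons_append, cyclicChain, chain_concat, chain_cons, mul_comm]

theorem exists_eq_cons_concat {α : Type*} {l : List α} (hl : 2 ≤ l.length) :
    ∃ a m b, l = a :: (m ++ [b]) := by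
  cases l with
  | nil => simp at hl
  | cons a l =>
    obtain rfl | ⟨m, b, rfl⟩ := List.eq_nil_or_concat' l
    · simp at hl
    · exact ⟨a, m, b, rfl⟩

/-- The loop replaces the closing edge b → a of the cycle by the detour b → x → a, and
1/((x−a)(b−x)) = (1/(x−a) − 1/(x−b))/(b−a). Two letters are needed for a ≠ b. -/
theorem chain_self_eq_cyclicChain {x : ℂ} {l : List ℂ} (hl : 2 ≤ l.length) (hn : l.Nodup)
    (hx : x ∉ l) (d : ℂ) :
    chain x l x = cyclicChain l * ((x - l.headD d)⁻¹ - (x - l.getLastD d)⁻¹) := by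
  obtain ⟨a, m, b, rfl⟩ := exists_eq_cons_concat hl
  have hab : b ≠ a := by
    rintro rfl
    simp at hn
  simp only [List.mem_cons, List.mem_append, not_or] at hx
  have h1 : x - a ≠ 0 := sub_ne_zero.2 hx.1
  have h2 : x - b ≠ 0 := sub_ne_zero.2 hx.2.2.1
  have h3 : b - a ≠ 0 := sub_ne_zero.2 hab
  have h4 : b - x ≠ 0 := sub_ne_zero.2 (Ne.symm hx.2.2.1)
  have hl : (a :: (m ++ [b])).getLastD d = b := by
    rw [List.getLastD_cons, List.getLastD_concat]
  rw [hl, List.headD_cons, cyclicChain, chain_cons, chain_concat, chain_concat]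
  field_simp
  ring

/-- Inserting x between consecutive points p, q multiplies the chain by 1/(x−q) − 1/(x−p), so the
sum over positions telescopes. The cut after the whole list contributes nothing because `chain x []
x = 0`. -/
theorem sum_chain_take_mul_chain_drop {x : ℂ} (y : ℂ) {l : List ℂ} (hn : (y :: l).Nodup)
    (hx : x ∉ y :: l) :
    ∑ k ∈ Finset.range (l.length + 1), chain y (l.take k) x * chain x (l.drop k) x =
      chain y l x * ((x - l.getLastD y)⁻¹ - (x - y)⁻¹) := by
  induction l generalizing y with
  | nil => simp [chain_nil]
  | cons a l ih =>
    simp only [List.mem_cons, not_or] at hx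
    rw [List.length_cons, Finset.sum_range_succ']
    simp only [List.take_succ_cons, List.drop_succ_cons, chain_cons, List.take_zero,
      List.drop_zero, mul_assoc]
    rw [← Finset.mul_sum, ih a (List.nodup_cons.1 hn).2 (by simpa using hx.2), chain_nil,
      List.getLastD_cons]
    have h1 : y - x ≠ 0 := sub_ne_zero.2 (Ne.symm hx.1)
    have h2 : x - a ≠ 0 := sub_ne_zero.2 hx.2.1
    have h3 : y - a ≠ 0 := by
      rw [sub_ne_zero]
      rintro rfl
      simp at hn
    have h4 : (y - x)⁻¹ * (x - a)⁻¹ = (y - a)⁻¹ * ((x - a)⁻¹ - (x - y)⁻¹) := by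
      rw [← neg_sub y x]
      field_simp
      ring
    linear_combination (chain a l x) * h4

theorem sum_chain_self_take_mul_drop {x : ℂ} {l : List ℂ} (hn : l.Nodup) (hx : x ∉ l) (d : ℂ) :
    ∑ k ∈ Finset.range (l.length + 1), chain x (l.take k) x * chain x (l.drop k) x =
      chain x l x * ((x - l.getLastD d)⁻¹ - (x - l.headD d)⁻¹) := by
  cases l with
  | nil => simp [chain_nil]
  | cons a l =>
    rw [List.length_cons, Finset.sum_range_succ']
    simp only [List.take_succ_cons, List.drop_succ_cons, chain_cons, List.take_zero,
      List.drop_zero, mul_assoc, chain_nil_self, zero_mul, add_zero]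
    rw [← Finset.mul_sum, sum_chain_take_mul_chain_drop a hn hx, List.getLastD_cons,
      List.headD_cons]

/-- Words are regrouped by first letter in one sum and by last letter in the other. The bracket
vanishes when F is cyclic and is a commutator when F is a matrix product. -/
theorem sum_head_sub_last {α A : Type*} [DecidableEq α] [Ring A] {S : Finset α}
    (hS : S.Nonempty) (d : α) (e : α → A) (F : List α → A) :
    ∑ l ∈ orderings S, (e (l.headD d) - e (l.getLastD d)) * F l =
      ∑ a ∈ S, e a * ∑ m ∈ orderings (S.erase a), (F (a :: m) - F (m ++ [a])) := by
  simp_rw [sub_mul, Finset.sum_sub_distrib, mul_sub, Finset.mul_sum]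
  rw [sum_orderings_cons hS, sum_orderings_concat hS]
  simp

/-- Invariance of a function of lists under cyclic rotation. -/
def IsCyclic (c : List ℂ → ℂ) : Prop := ∀ a l, c (a :: l) = c (l ++ [a])

theorem isCyclic_cyclicChain : IsCyclic cyclicChain := fun a l =>
  (cyclicChain_concat a l).symm

theorem isCyclic_const (b : ℂ) : IsCyclic fun _ => b := fun _ _ => rfl

theorem isCyclic_trace_prod {n : Type*} [Fintype n] [DecidableEq n] (f : ℂ → Matrix n n ℂ) :
    IsCyclic fun l => ((l.map f).prod).trace := fun a l => by
  simp only [List.map_cons, List.prod_cons]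
  rw [Matrix.trace_mul_comm, List.map_append, List.prod_append]
  simp

theorem length_nodup_notMem {S : Finset ℂ} {x : ℂ} (hx : x ∉ S) {l : List ℂ}
    (hl : l ∈ orderings S) : l.length = S.card ∧ l.Nodup ∧ x ∉ l :=
  ⟨length_of_mem_orderings hl, (mem_orderings.1 hl).1, by rwa [mem_of_mem_orderings hl]⟩

theorem IsCyclic.sum_chain_eq_zero {c : List ℂ → ℂ} (hc : IsCyclic c) {S : Finset ℂ}
    (hS : 2 ≤ S.card) {x : ℂ} (hx : x ∉ S) :
    ∑ l ∈ orderings S, chain x l x * c l = 0 := by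
  have hne : S.Nonempty := Finset.card_pos.1 (by omega)
  have h := sum_head_sub_last hne 0 (fun a => (x - a)⁻¹) (fun l => cyclicChain l * c l)
  have h0 : ∀ a m, cyclicChain (a :: m) * c (a :: m)
      - cyclicChain (m ++ [a]) * c (m ++ [a]) = 0 := fun a m => by
    rw [← isCyclic_cyclicChain, ← hc, sub_self]
  simp only [h0, Finset.sum_const_zero, mul_zero] at h
  rw [← h]
  refine Finset.sum_congr rfl fun l hl => ?_
  obtain ⟨h1, h2, h3⟩ := length_nodup_notMem hx hl
  rw [chain_self_eq_cyclicChain (by omega) h2 h3 0]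
  ring

theorem sum_split_chain {V : Type*} [AddCommGroup V] [Module ℂ V] (φ : List ℂ → V)
    {S : Finset ℂ} {x : ℂ} (hx : x ∉ S) (d : ℂ) :
    ∑ J ∈ S.powerset, ∑ l₁ ∈ orderings J, ∑ l₂ ∈ orderings (S \ J),
        (chain x l₁ x * chain x l₂ x) • φ (l₁ ++ l₂) =
      ∑ l ∈ orderings S,
        (chain x l x * ((x - l.getLastD d)⁻¹ - (x - l.headD d)⁻¹)) • φ l := by
  rw [sum_orderings_split S fun l₁ l₂ => (chain x l₁ x * chain x l₂ x) • φ (l₁ ++ l₂)]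
  refine Finset.sum_congr rfl fun l hl => ?_
  obtain ⟨h1, h2, h3⟩ := length_nodup_notMem hx hl
  simp only [List.take_append_drop]
  rw [← Finset.sum_smul, ← h1, sum_chain_self_take_mul_drop h2 h3]

/-- After regrouping it holds word by word: for a word from a to b with A = 1/(x−a), B = 1/(x−b), it
reads (A² + B²)/2 − (A − B)/(a−b) − (A − B)²/2 = 0, which is A − B = (a−b)AB. -/
theorem IsCyclic.sum_cyclicChain_add_sum_split {c : List ℂ → ℂ} (hc : IsCyclic c)
    {S : Finset ℂ} (hS : 2 ≤ S.card) {x : ℂ} (hx : x ∉ S) (d : ℂ) :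
    ∑ j ∈ S, ∑ m ∈ orderings (S.erase j), c (j :: m) * chain j m j *
        ((x - j)⁻¹ ^ 2 - (x - j)⁻¹ * ((j - m.headD d)⁻¹ + (j - m.getLastD d)⁻¹)) +
      (∑ J ∈ S.powerset, ∑ l₁ ∈ orderings J, ∑ l₂ ∈ orderings (S \ J),
        chain x l₁ x * chain x l₂ x * c (l₁ ++ l₂)) / 2 = 0 := by
  have hne : S.Nonempty := Finset.card_pos.1 (by omega)
  have h2 := sum_split_chain c hx d
  simp only [smul_eq_mul] at h2
  rw [h2]
  set F : List ℂ → ℂ := fun l => cyclicChain l * c l with hF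
  have hFc : IsCyclic F := fun a m => by
    simp only [hF]
    rw [← isCyclic_cyclicChain, ← hc]
  have e1 := sum_orderings_cons hne fun l => F l * (x - l.headD d)⁻¹ ^ 2
  have e2 := sum_orderings_concat hne fun l => F l * (x - l.getLastD d)⁻¹ ^ 2
  have e3 := sum_orderings_cons hne fun l =>
    F l * ((x - l.headD d)⁻¹ * (l.headD d - l.getLastD d)⁻¹)
  have e4 := sum_orderings_concat hne fun l =>
    F l * ((x - l.getLastD d)⁻¹ * (l.getLastD d - l.headD d)⁻¹)
  -- A cycle pointed at j is read both as `j :: m` and as `m ++ [j]`. The square is shared equally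
  -- between the readings; the two neighbours of j are the last letter in the first reading and the
  -- first letter in the second.
  have hsplit : ∑ j ∈ S, ∑ m ∈ orderings (S.erase j), c (j :: m) * chain j m j *
        ((x - j)⁻¹ ^ 2 - (x - j)⁻¹ * ((j - m.headD d)⁻¹ + (j - m.getLastD d)⁻¹)) =
      ∑ l ∈ orderings S, (F l * (x - l.headD d)⁻¹ ^ 2) / 2
      + ∑ l ∈ orderings S, (F l * (x - l.getLastD d)⁻¹ ^ 2) / 2
      - ∑ l ∈ orderings S, F l * ((x - l.headD d)⁻¹ * (l.headD d - l.getLastD d)⁻¹)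
      - ∑ l ∈ orderings S,
          F l * ((x - l.getLastD d)⁻¹ * (l.getLastD d - l.headD d)⁻¹) := by
    rw [← Finset.sum_div, ← Finset.sum_div, e1, e2, e3, e4]
    simp only [Finset.sum_div, ← Finset.sum_add_distrib, ← Finset.sum_sub_distrib]
    refine Finset.sum_congr rfl fun j hj => Finset.sum_congr rfl fun m hm => ?_
    have hm0 : m ≠ [] := by
      rintro rfl
      have := length_of_mem_orderings hm
      rw [Finset.card_erase_of_mem hj, List.length_nil] at this
      omega
    obtain ⟨b, m', rfl⟩ := List.exists_cons_of_ne_nil hm0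
    rw [← hFc]
    simp only [hF, cyclicChain, List.headD_cons, List.getLastD_cons, List.cons_append,
      List.getLastD_concat]
    ring
  rw [hsplit, ← Finset.sum_add_distrib, ← Finset.sum_sub_distrib, ← Finset.sum_sub_distrib,
    Finset.sum_div, ← Finset.sum_add_distrib]
  refine Finset.sum_eq_zero fun l hl => ?_
  obtain ⟨h1, hn, h3⟩ := length_nodup_notMem hx hl
  rw [chain_self_eq_cyclicChain (by omega) hn h3 d]
  obtain ⟨a, m, b, rfl⟩ := exists_eq_cons_concat (l := l) (by omega)
  have hab : b ≠ a := by
    rintro rfl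
    simp at hn
  simp only [List.mem_cons, List.mem_append, not_or] at h3
  have h1 : x - a ≠ 0 := sub_ne_zero.2 h3.1
  have h2 : x - b ≠ 0 := sub_ne_zero.2 h3.2.2.1
  have h4 : b - a ≠ 0 := sub_ne_zero.2 hab
  have hl : (a :: (m ++ [b])).getLastD d = b := by
    rw [List.getLastD_cons, List.getLastD_concat]
  rw [hl, List.headD_cons, ← neg_sub b a]
  simp only [hF]
  field_simp
  ring

/-! ### Scalar and matrix sums over loops. -/

/-- The sum of the chains from `x` to `x` through all the orderings of `S`. -/
noncomputable def chainSum (S : Finset ℂ) (x : ℂ) : ℂ := ∑ l ∈ orderings S, chain x l x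

/-- The sum over the orderings of `S` of the ordered products of the matrices `f a`, `a ∈ S`,
weighted with the chains from `x` to `x`. -/
noncomputable def matSum {n : Type*} [Fintype n] [DecidableEq n] (f : ℂ → Matrix n n ℂ)
    (S : Finset ℂ) (x : ℂ) : Matrix n n ℂ :=
  ∑ l ∈ orderings S, chain x l x • (l.map f).prod

theorem chainSum_empty (x : ℂ) : chainSum ∅ x = 0 := by
  simp [chainSum, orderings_empty, chain_nil]

theorem orderings_singleton {α : Type*} [DecidableEq α] (a : α) :
    orderings ({a} : Finset α) = {[a]} := by
  ext l
  rw [Finset.mem_singleton]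
  constructor
  · intro h
    have h1 := length_of_mem_orderings h
    rw [Finset.card_singleton, List.length_eq_one_iff] at h1
    obtain ⟨b, rfl⟩ := h1
    rw [List.singleton_inj, ← Finset.mem_singleton, ← mem_of_mem_orderings h]
    simp
  · rintro rfl
    exact mem_orderings.2 ⟨List.nodup_singleton a, rfl⟩

theorem chainSum_singleton (a x : ℂ) : chainSum {a} x = -(x - a)⁻¹ ^ 2 := by
  rw [chainSum, orderings_singleton, Finset.sum_singleton, chain_cons, chain_nil, ← neg_sub x a,
    inv_neg]
  ring

/-- Only singletons have a nonzero `chainSum`, so subtracting it encodes the δ_{k,2} term of W_k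
uniformly in k. -/
theorem chainSum_eq_zero {S : Finset ℂ} (hS : 2 ≤ S.card) {x : ℂ} (hx : x ∉ S) :
    chainSum S x = 0 := by
  simpa [chainSum] using (isCyclic_const 1).sum_chain_eq_zero hS hx

section Matrix

variable {n : Type*} [Fintype n] [DecidableEq n] (f : ℂ → Matrix n n ℂ)

theorem matSum_empty (x : ℂ) : matSum f ∅ x = 0 := by
  simp [matSum, orderings_empty, chain_nil]

theorem trace_matSum {S : Finset ℂ} {x : ℂ} (hx : x ∉ S) (hf : ∀ a ∈ S, (f a).trace = 1) :
    (matSum f S x).trace = chainSum S x := by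
  rcases Nat.lt_or_ge S.card 2 with h | h
  · rcases Nat.lt_or_ge S.card 1 with h' | h'
    · obtain rfl := Finset.card_eq_zero.1 (Nat.lt_one_iff.1 h')
      simp [matSum_empty, chainSum_empty]
    · obtain ⟨a, rfl⟩ := Finset.card_eq_one.1 (by omega : S.card = 1)
      simp [matSum, chainSum, orderings_singleton, hf a (Finset.mem_singleton_self a)]
  · rw [chainSum_eq_zero h hx, matSum, Matrix.trace_sum,
      ← (isCyclic_trace_prod f).sum_chain_eq_zero h hx]
    simp [Matrix.trace_smul]

theorem sum_matSum_mul_matSum {S : Finset ℂ} {x : ℂ} (hx : x ∉ S) (d : ℂ) :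
    ∑ J ∈ S.powerset, matSum f J x * matSum f (S \ J) x =
      ∑ l ∈ orderings S,
        (chain x l x * ((x - l.getLastD d)⁻¹ - (x - l.headD d)⁻¹)) • (l.map f).prod := by
  rw [← sum_split_chain _ hx]
  simp only [matSum, Finset.sum_mul_sum, List.map_append, List.prod_append, smul_mul_smul_comm]

/-- A matrix word is cyclic only under the trace, so the coefficient of 1/(x − j) keeps a
commutator. -/
theorem matSum_eq_sum_commutator {S : Finset ℂ} (hS : 2 ≤ S.card) {x : ℂ} (hx : x ∉ S) :
    matSum f S x =
      ∑ j ∈ S, (x - j)⁻¹ • (f j * matSum f (S.erase j) j - matSum f (S.erase j) j * f j) := by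
  have hne : S.Nonempty := Finset.card_pos.1 (by omega)
  have h := sum_head_sub_last hne 0 (fun a => algebraMap ℂ (Matrix n n ℂ) (x - a)⁻¹)
    (fun l => cyclicChain l • (l.map f).prod)
  simp only [← map_sub, ← Algebra.smul_def] at h
  rw [matSum]
  refine Eq.trans (Finset.sum_congr rfl fun l hl => ?_) (h.trans
    (Finset.sum_congr rfl fun j hj => ?_))
  · obtain ⟨h1, h2, h3⟩ := length_nodup_notMem hx hl
    rw [chain_self_eq_cyclicChain (by omega) h2 h3 0, smul_smul, mul_comm]
  · congr 1
    simp only [matSum, Finset.mul_sum, Finset.sum_mul, ← Finset.sum_sub_distrib]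
    refine Finset.sum_congr rfl fun m hm => ?_
    rw [cyclicChain_concat]
    simp [cyclicChain]

/-- The cyclic identity for the trace of a word minus the same identity for the constant weight 1.
This is the cancellation of T in the loop equation. -/
theorem sum_trace_cyclicChain {S : Finset ℂ} (hS : 2 ≤ S.card) {x : ℂ} (hx : x ∉ S) (d : ℂ) :
    ∑ j ∈ S, ∑ m ∈ orderings (S.erase j), ((f j * (m.map f).prod).trace - 1) * (chain j m j *
        ((x - j)⁻¹ ^ 2 - (x - j)⁻¹ * ((j - m.headD d)⁻¹ + (j - m.getLastD d)⁻¹))) +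
      (∑ J ∈ S.powerset, ((matSum f J x * matSum f (S \ J) x).trace
        - chainSum J x * chainSum (S \ J) x)) / 2 = 0 := by
  have h1 := (isCyclic_trace_prod f).sum_cyclicChain_add_sum_split hS hx d
  have h2 := (isCyclic_const 1).sum_cyclicChain_add_sum_split hS hx d
  have e1 : ∀ J ∈ S.powerset, ∑ l₁ ∈ orderings J, ∑ l₂ ∈ orderings (S \ J),
      chain x l₁ x * chain x l₂ x * (((l₁ ++ l₂).map f).prod).trace =
        (matSum f J x * matSum f (S \ J) x).trace := fun J _ => by
    simp only [matSum, Finset.sum_mul_sum, List.map_append, List.prod_append,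
      smul_mul_smul_comm, Matrix.trace_sum, Matrix.trace_smul, smul_eq_mul]
  have e2 : ∀ J ∈ S.powerset, ∑ l₁ ∈ orderings J, ∑ l₂ ∈ orderings (S \ J),
      chain x l₁ x * chain x l₂ x * 1 = chainSum J x * chainSum (S \ J) x := fun J _ => by
    simp only [chainSum, Finset.sum_mul_sum, mul_one]
  rw [Finset.sum_congr rfl e1] at h1
  rw [Finset.sum_congr rfl e2] at h2
  rw [Finset.sum_sub_distrib, sub_div]
  have e3 : ∑ j ∈ S, ∑ m ∈ orderings (S.erase j), ((f j * (m.map f).prod).trace - 1) *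
      (chain j m j * ((x - j)⁻¹ ^ 2 - (x - j)⁻¹ * ((j - m.headD d)⁻¹ + (j - m.getLastD d)⁻¹))) =
      ∑ j ∈ S, ∑ m ∈ orderings (S.erase j), (((j :: m).map f).prod).trace * chain j m j *
        ((x - j)⁻¹ ^ 2 - (x - j)⁻¹ * ((j - m.headD d)⁻¹ + (j - m.getLastD d)⁻¹)) -
      ∑ j ∈ S, ∑ m ∈ orderings (S.erase j), 1 * chain j m j *
        ((x - j)⁻¹ ^ 2 - (x - j)⁻¹ * ((j - m.headD d)⁻¹ + (j - m.getLastD d)⁻¹)) := by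
    simp only [← Finset.sum_sub_distrib, List.map_cons, List.prod_cons]
    refine Finset.sum_congr rfl fun j _ => Finset.sum_congr rfl fun m _ => by ring
  rw [e3]
  linear_combination h1 - h2

end Matrix

/-- The polarized Cayley-Hamilton identity for `2 × 2` matrices. -/
theorem mul_add_mul_comm_eq {R : Type*} [CommRing R] (A B : Matrix (Fin 2) (Fin 2) R) :
    A * B + B * A = A.trace • B + B.trace • A + ((A * B).trace - A.trace * B.trace) • 1 := by
  ext i j
  fin_cases i <;> fin_cases j <;>
    simp [Matrix.mul_apply, Fin.sum_univ_two, Matrix.trace] <;> ring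

theorem sum_trace_mul_matSum_mul_matSum (f : ℂ → Matrix (Fin 2) (Fin 2) ℂ)
    (X : Matrix (Fin 2) (Fin 2) ℂ) {S : Finset ℂ} {x : ℂ} (hx : x ∉ S)
    (hf : ∀ a ∈ S, (f a).trace = 1) :
    ∑ J ∈ S.powerset, (X * (matSum f J x * matSum f (S \ J) x)).trace =
      ∑ J ∈ S.powerset, chainSum J x * (X * matSum f (S \ J) x).trace +
      X.trace * (∑ J ∈ S.powerset, ((matSum f J x * matSum f (S \ J) x).trace
        - chainSum J x * chainSum (S \ J) x)) / 2 := by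
  have hswap : ∀ F : Finset ℂ → Finset ℂ → ℂ,
      ∑ J ∈ S.powerset, F J (S \ J) = ∑ J ∈ S.powerset, F (S \ J) J := fun F => by
    refine Finset.sum_nbij' (fun J => S \ J) (fun J => S \ J) ?_ ?_ ?_ ?_ ?_
    · exact fun J _ => Finset.mem_powerset.2 Finset.sdiff_subset
    · exact fun J _ => Finset.mem_powerset.2 Finset.sdiff_subset
    · exact fun J hJ => Finset.sdiff_sdiff_eq_self (Finset.mem_powerset.1 hJ)
    · exact fun J hJ => Finset.sdiff_sdiff_eq_self (Finset.mem_powerset.1 hJ)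
    · intro J hJ
      rw [Finset.sdiff_sdiff_eq_self (Finset.mem_powerset.1 hJ)]
  have h1 := hswap fun J J' => (X * (matSum f J x * matSum f J' x)).trace
  have h2 := hswap fun J J' => chainSum J x * (X * matSum f J' x).trace
  -- Averaging J with its complement replaces each product by half an anticommutator, to which the
  -- polarized Cayley-Hamilton identity applies.
  have h3 : ∀ J ∈ S.powerset, (X * (matSum f J x * matSum f (S \ J) x)).trace +
      (X * (matSum f (S \ J) x * matSum f J x)).trace =
      chainSum J x * (X * matSum f (S \ J) x).trace +
      chainSum (S \ J) x * (X * matSum f J x).trace +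
      X.trace * ((matSum f J x * matSum f (S \ J) x).trace
        - chainSum J x * chainSum (S \ J) x) := fun J hJ => by
    have hs := Finset.mem_powerset.1 hJ
    have t1 := trace_matSum f (fun h => hx (hs h)) fun a ha => hf a (hs ha)
    have t2 := trace_matSum f (S := S \ J) (x := x) (fun h => hx (Finset.sdiff_subset h))
      fun a ha => hf a (Finset.sdiff_subset ha)
    rw [← Matrix.trace_add, ← mul_add, mul_add_mul_comm_eq, t1, t2]
    simp only [mul_add, Matrix.mul_smul, Matrix.trace_add, Matrix.trace_smul, smul_eq_mul,
      mul_one]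
    ring
  have h4 := Finset.sum_congr rfl h3
  simp only [Finset.sum_add_distrib, ← Finset.mul_sum] at h4
  linear_combination (h4 + h1 - h2) / 2

end LoopEq

/-! ### The kernel as a trace, and its derivatives. -/

namespace LoopEq

variable (Ψ : ℂ → Matrix (Fin 2) (Fin 2) ℂ)

/-- The rank one matrix with the column of `M z` and the row of `M y`. -/
def bilocal (y z : ℂ) : Matrix (Fin 2) (Fin 2) ℂ :=
  Matrix.vecMulVec (fun i => Ψ z i 1) (fun i => Ψ y i 0) * !![0, 1; -1, 0]

theorem bilocal_self (x : ℂ) : bilocal Ψ x x = M Ψ x := rfl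

theorem trace_bilocal_mul (y z : ℂ) (N : Matrix (Fin 2) (Fin 2) ℂ) :
    (bilocal Ψ y z * N).trace =
      Ψ y 0 0 * (N 1 0 * Ψ z 0 1 + N 1 1 * Ψ z 1 1)
        - Ψ y 1 0 * (N 0 0 * Ψ z 0 1 + N 0 1 * Ψ z 1 1) := by
  simp [bilocal, Matrix.trace, Matrix.mul_apply, Matrix.vecMulVec, Fin.sum_univ_two]
  ring

theorem K_eq_trace (y z : ℂ) : K Ψ y z = (y - z)⁻¹ * (bilocal Ψ y z).trace := by
  have h := trace_bilocal_mul Ψ y z 1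
  simp only [mul_one] at h
  rw [h, K]
  simp
  ring

/-- By rank one, `bilocal y z * M a` is `bilocal a z` times the scalar (row of y) · (column of a),
and this scalar is the numerator of K(y, a). -/
theorem trace_bilocal_mul_M_mul (y a z : ℂ) (N : Matrix (Fin 2) (Fin 2) ℂ) :
    (bilocal Ψ y z * (M Ψ a * N)).trace =
      (bilocal Ψ y a).trace * (bilocal Ψ a z * N).trace := by
  have h := trace_bilocal_mul Ψ y a 1
  simp only [mul_one] at h
  rw [h, trace_bilocal_mul, trace_bilocal_mul]
  simp [M, Matrix.mul_apply, Matrix.vecMulVec, Fin.sum_univ_two]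
  ring

theorem path_K_eq (y z : ℂ) (l : List ℂ) :
    path (K Ψ) y l z = chain y l z * (bilocal Ψ y z * (l.map (M Ψ)).prod).trace := by
  induction l generalizing y with
  | nil => simp [path_nil, chain_nil, K_eq_trace]
  | cons a l ih =>
    rw [path_cons, chain_cons, List.map_cons, List.prod_cons, trace_bilocal_mul_M_mul, ih,
      K_eq_trace]
    ring

theorem trace_M (x : ℂ) (hx : (Ψ x).det = 1) : (M Ψ x).trace = 1 := by
  have h := trace_bilocal_mul Ψ x x 1
  rw [mul_one, bilocal_self] at h
  rw [h, ← hx, Matrix.det_fin_two]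
  simp
  ring

theorem M_mul_self (x : ℂ) (hx : (Ψ x).det = 1) : M Ψ x * M Ψ x = M Ψ x := by
  rw [Matrix.det_fin_two] at hx
  ext i j
  fin_cases i <;> fin_cases j <;>
    simp [M, Matrix.mul_apply, Matrix.vecMulVec, Fin.sum_univ_two]
  · linear_combination (-Ψ x 0 1 * Ψ x 1 0) * hx
  · linear_combination (Ψ x 0 1 * Ψ x 0 0) * hx
  · linear_combination (-Ψ x 1 1 * Ψ x 1 0) * hx
  · linear_combination (Ψ x 1 1 * Ψ x 0 0) * hx

theorem M_mul_mul_M (x : ℂ) (N : Matrix (Fin 2) (Fin 2) ℂ) :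
    M Ψ x * N * M Ψ x = (M Ψ x * N).trace • M Ψ x := by
  ext i j
  fin_cases i <;> fin_cases j <;>
    simp [M, Matrix.mul_apply, Matrix.vecMulVec, Fin.sum_univ_two, Matrix.trace] <;> ring

/-- The sum over the orderings of `S` of the products of the kernel along the path from `y` to
`z` through `S`. -/
noncomputable def pathSum (S : Finset ℂ) (y z : ℂ) : ℂ := ∑ l ∈ orderings S, path (K Ψ) y l z

theorem pathSum_empty (y z : ℂ) : pathSum Ψ ∅ y z = K Ψ y z := by
  simp [pathSum, orderings_empty, path_nil]

theorem pathSum_self (S : Finset ℂ) (x : ℂ) :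
    pathSum Ψ S x x = (M Ψ x * matSum (M Ψ) S x).trace := by
  simp [pathSum, path_K_eq, matSum, Finset.mul_sum, Matrix.trace_sum, bilocal_self]

theorem pathSum_insert {S : Finset ℂ} {a : ℂ} (ha : a ∉ S) (y z : ℂ) :
    pathSum Ψ (insert a S) y z =
      ∑ J ∈ S.powerset, pathSum Ψ J y a * pathSum Ψ (S \ J) a z := by
  simp only [pathSum, sum_orderings_insert ha, path_append_cons, Finset.sum_mul_sum]

section Deriv

variable {Ψ} {z : ℂ} {E : Matrix (Fin 2) (Fin 2) ℂ}
  (hd : ∀ i j, HasDerivAt (fun w => Ψ w i j) ((E * Ψ z) i j) z)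

include hd

theorem hasDerivAt_trace_bilocal_right (y : ℂ) (N : Matrix (Fin 2) (Fin 2) ℂ) :
    HasDerivAt (fun w => (bilocal Ψ y w * N).trace) (E * bilocal Ψ y z * N).trace z := by
  rw [Matrix.trace_mul_cycle, Matrix.trace_mul_comm]
  simp only [trace_bilocal_mul]
  refine HasDerivAt.congr_deriv (((((hd 0 1).const_mul (N 1 0)).add
    ((hd 1 1).const_mul (N 1 1))).const_mul (Ψ y 0 0)).sub
    ((((hd 0 1).const_mul (N 0 0)).add ((hd 1 1).const_mul (N 0 1))).const_mul (Ψ y 1 0))) ?_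
  simp only [Matrix.mul_apply, Fin.sum_univ_two]
  ring

/-- The row factor is ψᵀA with A = !![0, 1; -1, 0], and EᵀA = −AE for traceless E; hence the minus
sign with E on the right. -/
theorem hasDerivAt_trace_bilocal_left (hE : E.trace = 0) (y : ℂ)
    (N : Matrix (Fin 2) (Fin 2) ℂ) :
    HasDerivAt (fun w => (bilocal Ψ w y * N).trace) (-(bilocal Ψ z y * E * N).trace) z := by
  rw [mul_assoc]
  simp only [trace_bilocal_mul]
  refine HasDerivAt.congr_deriv (((hd 0 0).mul_const _).sub ((hd 1 0).mul_const _)) ?_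
  rw [Matrix.trace_fin_two] at hE
  simp only [Matrix.mul_apply, Fin.sum_univ_two]
  have h : E 1 1 = -E 0 0 := by linear_combination hE
  rw [h]
  ring

theorem hasDerivAt_trace_M_mul (hE : E.trace = 0) (N : Matrix (Fin 2) (Fin 2) ℂ) :
    HasDerivAt (fun w => (M Ψ w * N).trace) ((E * M Ψ z - M Ψ z * E) * N).trace z := by
  simp only [← bilocal_self]
  have e : ((E * bilocal Ψ z z - bilocal Ψ z z * E) * N).trace =
      (bilocal Ψ z z * (N * E)).trace - (bilocal Ψ z z * (E * N)).trace := by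
    rw [sub_mul, Matrix.trace_sub, Matrix.trace_mul_cycle, Matrix.trace_mul_comm, mul_assoc]
  rw [e]
  simp only [trace_bilocal_mul]
  refine HasDerivAt.congr_deriv
    (((hd 0 0).mul (((hd 0 1).const_mul (N 1 0)).add ((hd 1 1).const_mul (N 1 1)))).sub
    ((hd 1 0).mul (((hd 0 1).const_mul (N 0 0)).add ((hd 1 1).const_mul (N 0 1))))) ?_
  rw [Matrix.trace_fin_two] at hE
  have h : E 1 1 = -E 0 0 := by linear_combination hE
  simp only [Matrix.mul_apply, Fin.sum_univ_two, h, Pi.add_apply]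
  ring

end Deriv

theorem hasDerivAt_chain_left {l : List ℂ} {x : ℂ} (hl : l ≠ []) (hx : x ∉ l) (z d : ℂ) :
    HasDerivAt (fun t => chain t l z) (-(x - l.headD d)⁻¹ * chain x l z) x := by
  obtain ⟨a, m, rfl⟩ := List.exists_cons_of_ne_nil hl
  have h : x - a ≠ 0 := sub_ne_zero.2 fun h => hx (by simp [h])
  simp only [chain_cons, List.headD_cons]
  refine HasDerivAt.congr_deriv ((((hasDerivAt_id x).sub_const a).inv h).mul_const _) ?_
  simp only [id]
  field_simp

theorem hasDerivAt_chain_right {l : List ℂ} {x : ℂ} (hl : l ≠ []) (hx : x ∉ l) (y d : ℂ) :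
    HasDerivAt (fun t => chain y l t) (-(x - l.getLastD d)⁻¹ * chain y l x) x := by
  obtain h | ⟨m, a, rfl⟩ := List.eq_nil_or_concat' l
  · exact absurd h hl
  have h : x - a ≠ 0 := sub_ne_zero.2 fun h => hx (by simp [h])
  have h' : a - x ≠ 0 := sub_ne_zero.2 fun h => hx (by simp [h])
  simp only [chain_concat, List.getLastD_concat]
  refine HasDerivAt.congr_deriv ((((hasDerivAt_id x).const_sub a).inv h').const_mul _) ?_
  simp only [id]
  rw [← neg_sub x a]
  field_simp

theorem hasDerivAt_chain_self {l : List ℂ} {x : ℂ} (hl : l ≠ []) (hx : x ∉ l) (d : ℂ) :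
    HasDerivAt (fun t => chain t l t)
      (-((x - l.headD d)⁻¹ + (x - l.getLastD d)⁻¹) * chain x l x) x := by
  obtain ⟨a, m, rfl⟩ := List.exists_cons_of_ne_nil hl
  have h : x - a ≠ 0 := sub_ne_zero.2 fun h => hx (by simp [h])
  have hm : HasDerivAt (fun t => chain a m t) (-(x - m.getLastD a)⁻¹ * chain a m x) x := by
    by_cases hm : m = []
    · subst hm
      have h' : a - x ≠ 0 := sub_ne_zero.2 fun h => hx (by simp [h])
      simp only [chain_nil, List.getLastD_nil]
      refine HasDerivAt.congr_deriv (((hasDerivAt_id x).const_sub a).inv h') ?_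
      simp only [id]
      rw [← neg_sub x a]
      field_simp
    · exact hasDerivAt_chain_right hm (fun h => hx (List.mem_cons_of_mem _ h)) a a
  simp only [chain_cons, List.headD_cons, List.getLastD_cons]
  refine HasDerivAt.congr_deriv ((((hasDerivAt_id x).sub_const a).inv h).mul hm) ?_
  simp only [id, Pi.inv_apply]
  field_simp
  ring

variable {Ψ} {x : ℂ} {E : Matrix (Fin 2) (Fin 2) ℂ}

theorem hasDerivAt_pathSum_left (hE : E.trace = 0)
    (hd : ∀ i j, HasDerivAt (fun w => Ψ w i j) ((E * Ψ x) i j) x)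
    {S : Finset ℂ} (hS : S.Nonempty) (hx : x ∉ S) (z d : ℂ) :
    HasDerivAt (fun t => pathSum Ψ S t z) (∑ l ∈ orderings S, chain x l z *
      (-(x - l.headD d)⁻¹ * (bilocal Ψ x z * (l.map (M Ψ)).prod).trace
        - (bilocal Ψ x z * E * (l.map (M Ψ)).prod).trace)) x := by
  simp only [pathSum, path_K_eq]
  refine HasDerivAt.fun_sum fun l hl => ?_
  refine HasDerivAt.congr_deriv
    ((hasDerivAt_chain_left (ne_nil_of_mem_orderings hS hl) (length_nodup_notMem hx hl).2.2 z d).mul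
      (hasDerivAt_trace_bilocal_left hd hE z _)) ?_
  ring

theorem hasDerivAt_pathSum_right
    (hd : ∀ i j, HasDerivAt (fun w => Ψ w i j) ((E * Ψ x) i j) x)
    {S : Finset ℂ} (hS : S.Nonempty) (hx : x ∉ S) (y d : ℂ) :
    HasDerivAt (fun t => pathSum Ψ S y t) (∑ l ∈ orderings S, chain y l x *
      (-(x - l.getLastD d)⁻¹ * (bilocal Ψ y x * (l.map (M Ψ)).prod).trace
        + (E * bilocal Ψ y x * (l.map (M Ψ)).prod).trace)) x := by
  simp only [pathSum, path_K_eq]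
  refine HasDerivAt.fun_sum fun l hl => ?_
  refine HasDerivAt.congr_deriv
    ((hasDerivAt_chain_right (ne_nil_of_mem_orderings hS hl) (length_nodup_notMem hx hl).2.2 y d).mul
      (hasDerivAt_trace_bilocal_right hd y _)) ?_
  ring

/-- The numerator of K is det Ψ = 1 on the diagonal, so the limit is minus its derivative. The first
argument gives the same limit, so both singular terms of the split loop regularize to W_1. -/
theorem tendsto_K_sub_right
    (hd : ∀ i j, HasDerivAt (fun w => Ψ w i j) ((E * Ψ x) i j) x) (hdet : (Ψ x).det = 1) :
    Tendsto (fun t => K Ψ x t - 1 / (x - t)) (𝓝[≠] x) (𝓝 (-(E * M Ψ x).trace)) := by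
  have h := (hasDerivAt_trace_bilocal_right hd x 1).tendsto_slope.neg
  simp only [mul_one, bilocal_self] at h
  refine h.congr' ?_
  filter_upwards [self_mem_nhdsWithin] with t ht
  rw [slope_def_field, K_eq_trace, bilocal_self, trace_M Ψ x hdet, ← neg_sub t x]
  have h1 : t - x ≠ 0 := sub_ne_zero.2 ht
  field_simp
  ring

theorem tendsto_K_sub_left (hE : E.trace = 0)
    (hd : ∀ i j, HasDerivAt (fun w => Ψ w i j) ((E * Ψ x) i j) x) (hdet : (Ψ x).det = 1) :
    Tendsto (fun t => K Ψ t x - 1 / (t - x)) (𝓝[≠] x) (𝓝 (-(E * M Ψ x).trace)) := by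
  have h := (hasDerivAt_trace_bilocal_left hd hE x 1).tendsto_slope
  simp only [mul_one, bilocal_self] at h
  rw [Matrix.trace_mul_comm] at h
  refine h.congr' ?_
  filter_upwards [self_mem_nhdsWithin] with t ht
  rw [slope_def_field, K_eq_trace, bilocal_self, trace_M Ψ x hdet]
  have h1 : t - x ≠ 0 := sub_ne_zero.2 ht
  field_simp

theorem W_one_eq (hd : ∀ i j, HasDerivAt (fun w => Ψ w i j) ((E * Ψ x) i j) x)
    (hdet : (Ψ x).det = 1) {f : Fin 1 → ℂ} (hf : f 0 = x) :
    W Ψ 1 f = -(E * M Ψ x).trace := by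
  subst hf
  exact (tendsto_K_sub_right hd hdet).limUnder_eq

variable (Ψ) in
/-- Up to the sign `(-1) ^ S.card`, the correlation function at `x` and the points of `S`. -/
noncomputable def connected (S : Finset ℂ) (x : ℂ) : ℂ :=
  if S = ∅ then W Ψ 1 ![x] else pathSum Ψ S x x - chainSum S x

theorem connected_of_nonempty {S : Finset ℂ} (hS : S.Nonempty) (x : ℂ) :
    connected Ψ S x = (∑ l ∈ orderings S, chain x l x * ((M Ψ x * (l.map (M Ψ)).prod).trace - 1)) := by
  rw [connected, if_neg hS.ne_empty, pathSum, chainSum, ← Finset.sum_sub_distrib]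
  refine Finset.sum_congr rfl fun l _ => ?_
  rw [path_K_eq, bilocal_self]
  ring

theorem hasDerivAt_connected (hE : E.trace = 0)
    (hd : ∀ i j, HasDerivAt (fun w => Ψ w i j) ((E * Ψ x) i j) x)
    {S : Finset ℂ} (hS : S.Nonempty) (hx : x ∉ S) (d : ℂ) :
    HasDerivAt (connected Ψ S) (((E * M Ψ x - M Ψ x * E) * matSum (M Ψ) S x).trace -
      ∑ l ∈ orderings S, ((M Ψ x * (l.map (M Ψ)).prod).trace - 1) *
        (chain x l x * ((x - l.headD d)⁻¹ + (x - l.getLastD d)⁻¹))) x := by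
  have h0 : connected Ψ S = fun t => ∑ l ∈ orderings S,
      chain t l t * ((M Ψ t * (l.map (M Ψ)).prod).trace - 1) :=
    funext fun t => connected_of_nonempty hS t
  rw [h0, matSum, Finset.mul_sum, Matrix.trace_sum, ← Finset.sum_sub_distrib]
  refine HasDerivAt.fun_sum fun l hl => ?_
  refine HasDerivAt.congr_deriv
    ((hasDerivAt_chain_self (ne_nil_of_mem_orderings hS hl) (length_nodup_notMem hx hl).2.2 d).mul
      ((hasDerivAt_trace_M_mul hd hE _).sub_const 1)) ?_
  rw [Matrix.mul_smul, Matrix.trace_smul, smul_eq_mul]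
  ring

end LoopEq

/-! ### The limit of coinciding points. -/

namespace LoopEq

theorem sum_mul_chainSum_sdiff (F : Finset ℂ → ℂ) {S : Finset ℂ} {x : ℂ} (hx : x ∉ S) :
    ∑ J ∈ S.powerset, F J * chainSum (S \ J) x =
      -∑ j ∈ S, F (S.erase j) * (x - j)⁻¹ ^ 2 := by
  have hinj : Set.InjOn (fun j => S.erase j) S := fun a ha b hb h => by
    by_contra hab
    have : a ∈ S.erase b := Finset.mem_erase.2 ⟨hab, ha⟩
    rw [← show S.erase a = S.erase b from h] at this
    exact Finset.notMem_erase a S this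
  have h1 : ∑ J ∈ S.image (fun j => S.erase j), F J * chainSum (S \ J) x =
      ∑ J ∈ S.powerset, F J * chainSum (S \ J) x := by
    refine Finset.sum_subset ?_ ?_
    · intro J hJ
      obtain ⟨j, -, rfl⟩ := Finset.mem_image.1 hJ
      exact Finset.mem_powerset.2 (Finset.erase_subset _ _)
    · intro J hJ hJ'
      have hs := Finset.mem_powerset.1 hJ
      rcases Nat.lt_or_ge (S \ J).card 2 with h | h
      · rcases Nat.lt_or_ge (S \ J).card 1 with h' | h'
        · rw [Finset.card_eq_zero.1 (Nat.lt_one_iff.1 h'), chainSum_empty, mul_zero]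
        · obtain ⟨a, ha⟩ := Finset.card_eq_one.1 (by omega : (S \ J).card = 1)
          refine absurd (Finset.mem_image.2 ⟨a, ?_, ?_⟩) hJ'
          · exact Finset.sdiff_subset (ha ▸ Finset.mem_singleton_self a)
          · rw [Finset.erase_eq, ← ha, Finset.sdiff_sdiff_eq_self hs]
      · rw [chainSum_eq_zero h fun hh => hx (Finset.sdiff_subset hh), mul_zero]
  rw [← h1, Finset.sum_image hinj, ← Finset.sum_neg_distrib]
  refine Finset.sum_congr rfl fun j hj => ?_
  rw [Finset.sdiff_erase_self hj, chainSum_singleton]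
  ring

variable {Ψ : ℂ → Matrix (Fin 2) (Fin 2) ℂ} {x : ℂ} {E : Matrix (Fin 2) (Fin 2) ℂ}

/-- The weights contribute 1/(x−last) − 1/(x−head), which is the telescoped sum of the products G_J
G_{S∖J}. The matrices contribute −(ME + EM), and ME + EM = E + tr(EM)·1 by Cayley-Hamilton. -/
theorem hasDerivAt_pathSum_sub (hE : E.trace = 0)
    (hd : ∀ i j, HasDerivAt (fun w => Ψ w i j) ((E * Ψ x) i j) x) (hdet : (Ψ x).det = 1)
    {S : Finset ℂ} (hS : S.Nonempty) (hx : x ∉ S) (hM : ∀ a ∈ S, (M Ψ a).trace = 1) :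
    HasDerivAt (fun t => pathSum Ψ S t x - pathSum Ψ S x t)
      (-(E * matSum (M Ψ) S x).trace - (E * M Ψ x).trace * chainSum S x
        + ∑ J ∈ S.powerset, chainSum J x * pathSum Ψ (S \ J) x x
        + (∑ J ∈ S.powerset, ((matSum (M Ψ) J x * matSum (M Ψ) (S \ J) x).trace
          - chainSum J x * chainSum (S \ J) x)) / 2) x := by
  refine HasDerivAt.congr_deriv ((hasDerivAt_pathSum_left hE hd hS hx x 0).sub
    (hasDerivAt_pathSum_right hd hS hx x 0)) ?_
  have hG := sum_trace_mul_matSum_mul_matSum (M Ψ) (M Ψ x) hx hM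
  rw [trace_M Ψ x hdet, one_mul] at hG
  simp only [pathSum_self]
  have hCH := mul_add_mul_comm_eq (M Ψ x) E
  rw [trace_M Ψ x hdet, hE, Matrix.trace_mul_comm] at hCH
  have h1 : -(E * matSum (M Ψ) S x).trace - (E * M Ψ x).trace * chainSum S x =
      -((M Ψ x * E + E * M Ψ x) * matSum (M Ψ) S x).trace := by
    rw [hCH, ← trace_matSum (M Ψ) hx hM]
    simp [add_mul]
    ring
  have h2 : ∑ J ∈ S.powerset, (M Ψ x * (matSum (M Ψ) J x * matSum (M Ψ) (S \ J) x)).trace =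
      ∑ l ∈ orderings S, (chain x l x * ((x - l.getLastD 0)⁻¹ - (x - l.headD 0)⁻¹)) *
        (M Ψ x * (l.map (M Ψ)).prod).trace := by
    rw [← Matrix.trace_sum, ← Finset.mul_sum, sum_matSum_mul_matSum _ hx 0, Finset.mul_sum,
      Matrix.trace_sum]
    simp
  rw [h1, add_assoc, ← hG, h2, matSum, Finset.mul_sum, Matrix.trace_sum,
    ← Finset.sum_neg_distrib, ← Finset.sum_add_distrib, ← Finset.sum_sub_distrib]
  refine Finset.sum_congr rfl fun l _ => ?_
  rw [Matrix.mul_smul, Matrix.trace_smul, add_mul, Matrix.trace_add, bilocal_self, smul_eq_mul]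
  ring

/-- Division by zero gives K(x, x) = 0, so for S = ∅ the regularized value W_1 is added by hand. -/
theorem connected_eq (S : Finset ℂ) :
    connected Ψ S x =
      pathSum Ψ S x x + (if S = ∅ then W Ψ 1 ![x] else 0) - chainSum S x := by
  rw [connected]
  split_ifs with h
  · subst h
    rw [pathSum_empty, chainSum_empty, K]
    simp
  · ring

theorem tendsto_sum_pathSum_mul_pathSum (hE : E.trace = 0)
    (hd : ∀ i j, HasDerivAt (fun w => Ψ w i j) ((E * Ψ x) i j) x) (hdet : (Ψ x).det = 1)
    {S : Finset ℂ} (hS : S.Nonempty) (hx : x ∉ S) (hM : ∀ a ∈ S, (M Ψ a).trace = 1) :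
    Tendsto (fun t => ∑ J ∈ S.powerset, pathSum Ψ J x t * pathSum Ψ (S \ J) t x) (𝓝[≠] x)
      (𝓝 (∑ J ∈ S.powerset, connected Ψ J x * connected Ψ (S \ J) x
        + (E * matSum (M Ψ) S x).trace
        - (∑ J ∈ S.powerset, ((matSum (M Ψ) J x * matSum (M Ψ) (S \ J) x).trace
          - chainSum J x * chainSum (S \ J) x)) / 2
        - ∑ j ∈ S, connected Ψ (S.erase j) x * (x - j)⁻¹ ^ 2)) := by
  have hw := W_one_eq hd hdet (f := ![x]) rfl
  set w := W Ψ 1 ![x] with hwdef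
  set P : Finset ℂ → ℂ := fun J => pathSum Ψ J x x + if J = ∅ then w else 0 with hP
  have hA : ∀ J ⊆ S, Tendsto (fun t => pathSum Ψ J x t - if J = ∅ then 1 / (x - t) else 0)
      (𝓝[≠] x) (𝓝 (P J)) := by
    intro J hJ
    rcases J.eq_empty_or_nonempty with rfl | hne
    · simp only [pathSum_empty, if_true, hP, hw]
      have := tendsto_K_sub_right hd hdet
      simpa [K] using this
    · simp only [hP, if_neg hne.ne_empty, sub_zero, add_zero]
      exact (hasDerivAt_pathSum_right hd hne (fun h => hx (hJ h)) x 0).continuousAt.tendsto.mono_left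
        nhdsWithin_le_nhds
  have hB : ∀ J ⊆ S, Tendsto (fun t => pathSum Ψ J t x - if J = ∅ then 1 / (t - x) else 0)
      (𝓝[≠] x) (𝓝 (P J)) := by
    intro J hJ
    rcases J.eq_empty_or_nonempty with rfl | hne
    · simp only [pathSum_empty, if_true, hP, hw]
      have := tendsto_K_sub_left hE hd hdet
      simpa [K] using this
    · simp only [hP, if_neg hne.ne_empty, sub_zero, add_zero]
      exact (hasDerivAt_pathSum_left hE hd hne (fun h => hx (hJ h)) x
        0).continuousAt.tendsto.mono_left nhdsWithin_le_nhds
  have h1 : Tendsto (fun t => ∑ J ∈ S.powerset,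
      (pathSum Ψ J x t - if J = ∅ then 1 / (x - t) else 0) *
        (pathSum Ψ (S \ J) t x - if S \ J = ∅ then 1 / (t - x) else 0)) (𝓝[≠] x)
      (𝓝 (∑ J ∈ S.powerset, P J * P (S \ J))) :=
    tendsto_finsetSum _ fun J hJ =>
      (hA J (Finset.mem_powerset.1 hJ)).mul (hB (S \ J) Finset.sdiff_subset)
  have h2 := (hasDerivAt_pathSum_sub hE hd hdet hS hx hM).tendsto_slope
  -- With the poles of J = ∅ and J = S removed, every factor converges. The removed part is
  -- pathSum_S(t,x)/(x−t) + pathSum_S(x,t)/(t−x), minus a difference quotient at x of a function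
  -- that vanishes there.
  have h3 := h1.sub h2
  have hlim : ∑ J ∈ S.powerset, P J * P (S \ J) -
      (-(E * matSum (M Ψ) S x).trace - (E * M Ψ x).trace * chainSum S x
        + ∑ J ∈ S.powerset, chainSum J x * pathSum Ψ (S \ J) x x
        + (∑ J ∈ S.powerset, ((matSum (M Ψ) J x * matSum (M Ψ) (S \ J) x).trace
          - chainSum J x * chainSum (S \ J) x)) / 2) =
      ∑ J ∈ S.powerset, connected Ψ J x * connected Ψ (S \ J) x
        + (E * matSum (M Ψ) S x).trace
        - (∑ J ∈ S.powerset, ((matSum (M Ψ) J x * matSum (M Ψ) (S \ J) x).trace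
          - chainSum J x * chainSum (S \ J) x)) / 2
        - ∑ j ∈ S, connected Ψ (S.erase j) x * (x - j)⁻¹ ^ 2 := by
    have e1 := sum_mul_chainSum_sdiff (connected Ψ · x) hx
    have e2 : ∑ J ∈ S.powerset, chainSum J x * (if S \ J = ∅ then w else 0) =
        chainSum S x * w := by
      rw [Finset.sum_eq_single S]
      · simp
      · intro J hJ hJS
        rw [if_neg, mul_zero]
        rw [Finset.sdiff_eq_empty_iff_subset]
        exact fun h => hJS (Finset.Subset.antisymm (Finset.mem_powerset.1 hJ) h)
      · exact fun h => absurd (Finset.mem_powerset_self S) h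
    have e3 : ∑ J ∈ S.powerset, P J * P (S \ J) =
        ∑ J ∈ S.powerset, connected Ψ J x * connected Ψ (S \ J) x
        + ∑ J ∈ S.powerset, connected Ψ J x * chainSum (S \ J) x
        + ∑ J ∈ S.powerset, chainSum J x * pathSum Ψ (S \ J) x x
        + ∑ J ∈ S.powerset, chainSum J x * (if S \ J = ∅ then w else 0) := by
      simp only [← Finset.sum_add_distrib]
      refine Finset.sum_congr rfl fun J _ => ?_
      simp only [hP, connected_eq, ← hwdef]
      ring
    rw [e3, e1, e2, hw]
    ring
  rw [hlim] at h3
  refine h3.congr' ?_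
  filter_upwards [self_mem_nhdsWithin] with t ht
  have ht0 : t - x ≠ 0 := sub_ne_zero.2 ht
  rw [slope_def_field, sub_self, sub_zero]
  have e1 : ∑ J ∈ S.powerset, (if J = ∅ then 1 / (x - t) else 0) * pathSum Ψ (S \ J) t x =
      1 / (x - t) * pathSum Ψ S t x := by
    rw [Finset.sum_eq_single ∅]
    · simp
    · intro J _ hJ
      rw [if_neg hJ, zero_mul]
    · exact fun h => absurd (Finset.empty_mem_powerset S) h
  have e2 : ∑ J ∈ S.powerset, pathSum Ψ J x t * (if S \ J = ∅ then 1 / (t - x) else 0) =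
      pathSum Ψ S x t * (1 / (t - x)) := by
    rw [Finset.sum_eq_single S]
    · simp
    · intro J hJ hJS
      rw [if_neg, mul_zero]
      rw [Finset.sdiff_eq_empty_iff_subset]
      exact fun h => hJS (Finset.Subset.antisymm (Finset.mem_powerset.1 hJ) h)
    · exact fun h => absurd (Finset.mem_powerset_self S) h
  have e3 : ∑ J ∈ S.powerset, (pathSum Ψ J x t - if J = ∅ then 1 / (x - t) else 0) *
        (pathSum Ψ (S \ J) t x - if S \ J = ∅ then 1 / (t - x) else 0) =
      ∑ J ∈ S.powerset, pathSum Ψ J x t * pathSum Ψ (S \ J) t x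
      - ∑ J ∈ S.powerset, (if J = ∅ then 1 / (x - t) else 0) * pathSum Ψ (S \ J) t x
      - ∑ J ∈ S.powerset, pathSum Ψ J x t * (if S \ J = ∅ then 1 / (t - x) else 0) := by
    simp only [← Finset.sum_sub_distrib]
    refine Finset.sum_congr rfl fun J _ => ?_
    have : (if J = ∅ then 1 / (x - t) else 0) * (if S \ J = ∅ then 1 / (t - x) else 0) = 0 := by
      split_ifs with h h'
      · subst h
        rw [Finset.sdiff_empty] at h'
        exact absurd h' hS.ne_empty
      all_goals simp
    linear_combination this
  rw [e3, e1, e2, ← neg_sub t x]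
  field_simp
  ring

/-! ### Correlation functions as sums over paths. -/

variable (Ψ)

theorem sum_full_cycles_K {m : ℕ} (f : Fin (m + 2) → ℂ) (hf : Function.Injective f)
    (j : Fin (m + 2)) :
    W Ψ (m + 2) f = -(if m = 0 then 1 / (f 0 - f 1) ^ 2 else 0)
        - (-1) ^ (m + 2) * pathSum Ψ ((Finset.univ.image f).erase (f j)) (f j) (f j) := by
  have h := sum_full_cycles (fun a b => K Ψ (f a) (f b)) j
  have h1 : (Finset.univ.image f).erase (f j) = (Finset.univ.erase j).image f := by
    rw [Finset.image_erase hf]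
  simp only [← path_map (K Ψ) f] at h
  rw [W, h1, pathSum, sum_orderings_image hf, ← h]

theorem W_succ_eq {m : ℕ} (hm : m ≠ 0) (f : Fin (m + 1) → ℂ) (hf : Function.Injective f)
    (j : Fin (m + 1)) :
    W Ψ (m + 1) f = (-1) ^ m * connected Ψ ((Finset.univ.image f).erase (f j)) (f j) := by
  obtain ⟨k, rfl⟩ := Nat.exists_eq_succ_of_ne_zero hm
  have hcard : ((Finset.univ.image f).erase (f j)).card = k + 1 := by
    rw [Finset.card_erase_of_mem (Finset.mem_image_of_mem f (Finset.mem_univ j)),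
      Finset.card_image_of_injective _ hf, Finset.card_univ, Fintype.card_fin]
    rfl
  have hne : (Finset.univ.image f).erase (f j) ≠ ∅ := by
    intro h
    rw [h, Finset.card_empty] at hcard
    omega
  rw [sum_full_cycles_K Ψ f hf j, connected, if_neg hne]
  -- The δ_{k,2} term is the `chainSum` of the one remaining point.
  have hg : chainSum ((Finset.univ.image f).erase (f j)) (f j) =
      -if k = 0 then 1 / (f 0 - f 1) ^ 2 else 0 := by
    split_ifs with h
    · subst h
      have h1 : (Finset.univ.image f).erase (f j) = (Finset.univ.erase j).image f := by
        rw [Finset.image_erase hf]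
      rw [h1]
      fin_cases j
      · rw [show (Finset.univ.erase _ : Finset (Fin 2)) = {1} from rfl, Finset.image_singleton,
          chainSum_singleton]
        simp
      · rw [show (Finset.univ.erase _ : Finset (Fin 2)) = {0} from rfl, Finset.image_singleton,
          chainSum_singleton]
        simp
        ring
    · rw [chainSum_eq_zero (by omega) (Finset.notMem_erase _ _), neg_zero]
  rw [hg]
  split_ifs with h
  · subst h
    ring
  · rw [pow_succ (-1 : ℂ) k]
    ring

theorem W_cons_cons_eq {n : ℕ} (hn : n ≠ 0) {xs : Fin n → ℂ} (hxs : Function.Injective xs)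
    {x t : ℂ} (hx : ∀ j, x ≠ xs j) (ht : ∀ j, t ≠ xs j) (hxt : t ≠ x) :
    W Ψ (n + 2) (Fin.cons x (Fin.cons t xs)) = -(-1) ^ n *
      ∑ J ∈ (Finset.univ.image xs).powerset,
        pathSum Ψ J x t * pathSum Ψ (Finset.univ.image xs \ J) t x := by
  have hinj : Function.Injective (Fin.cons x (Fin.cons t xs) : Fin (n + 2) → ℂ) := by
    rw [Fin.cons_injective_iff, Fin.cons_injective_iff, Fin.range_cons]
    refine ⟨?_, ?_, hxs⟩
    · rintro (h | ⟨j, h⟩)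
      · exact hxt h.symm
      · exact hx j h.symm
    · rintro ⟨j, h⟩
      exact ht j h.symm
  have himg : (Finset.univ.image (Fin.cons x (Fin.cons t xs) : Fin (n + 2) → ℂ)).erase x =
      insert t (Finset.univ.image xs) := by
    ext y
    simp only [Finset.mem_erase, Finset.mem_image, Finset.mem_univ, true_and, Finset.mem_insert,
      Fin.exists_fin_succ, Fin.cons_zero, Fin.cons_succ]
    constructor
    · rintro ⟨h1, h2 | h2 | h2⟩
      · exact absurd h2.symm h1
      · exact Or.inl h2.symm
      · exact Or.inr h2
    · rintro (rfl | ⟨j, rfl⟩)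
      · exact ⟨hxt, Or.inr (Or.inl rfl)⟩
      · exact ⟨(hx j).symm, Or.inr (Or.inr ⟨j, rfl⟩)⟩
  have h := sum_full_cycles_K Ψ (Fin.cons x (Fin.cons t xs) : Fin (n + 2) → ℂ) hinj 0
  rw [if_neg hn, Fin.cons_zero, himg, pathSum_insert] at h
  · rw [h]
    ring
  · simpa using fun j h => ht j h.symm

theorem W_withPoint_eq {n : ℕ} {xs : Fin n → ℂ} (hxs : Function.Injective xs)
    {x : ℂ} (hx : ∀ j, x ≠ xs j) (J : Finset (Fin n)) :
    W Ψ (J.card + 1) (withPoint x xs J) = (-1) ^ J.card * connected Ψ (J.image xs) x := by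
  rcases J.eq_empty_or_nonempty with rfl | hJ
  · simp only [Finset.card_empty, pow_zero, one_mul, Finset.image_empty, connected, if_true]
    rfl
  · have hinj : Function.Injective (withPoint x xs J) := by
      rw [withPoint, Fin.cons_injective_iff]
      refine ⟨?_, hxs.comp (J.orderEmbOfFin rfl).injective⟩
      rintro ⟨i, h⟩
      exact hx _ h.symm
    rw [W_succ_eq Ψ hJ.card_pos.ne' _ hinj 0]
    congr 2
    have h0 : withPoint x xs J 0 = x := rfl
    rw [h0]
    ext y
    simp only [Finset.mem_erase, Finset.mem_image, Finset.mem_univ, true_and,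
      Fin.exists_fin_succ, withPoint, Fin.cons_zero, Fin.cons_succ]
    constructor
    · rintro ⟨h1, h2 | ⟨i, rfl⟩⟩
      · exact absurd h2.symm h1
      · exact ⟨_, J.orderEmbOfFin_mem rfl i, rfl⟩
    · rintro ⟨j, hj, rfl⟩
      refine ⟨(hx j).symm, Or.inr ?_⟩
      have : j ∈ Set.range (J.orderEmbOfFin rfl) := by
        rw [Finset.range_orderEmbOfFin]
        exact hj
      obtain ⟨i, rfl⟩ := this
      exact ⟨i, rfl⟩

theorem sum_W_mul_W_eq {n : ℕ} {xs : Fin n → ℂ} (hxs : Function.Injective xs)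
    {x : ℂ} (hx : ∀ j, x ≠ xs j) :
    ∑ J : Finset (Fin n), W Ψ (J.card + 1) (withPoint x xs J) *
        W Ψ (Jᶜ.card + 1) (withPoint x xs Jᶜ) =
      (-1) ^ n * ∑ J ∈ (Finset.univ.image xs).powerset,
        connected Ψ J x * connected Ψ (Finset.univ.image xs \ J) x := by
  rw [Finset.mul_sum]
  refine Finset.sum_bij (fun J _ => J.image xs) ?_ ?_ ?_ ?_
  · exact fun J _ => Finset.mem_powerset.2 (Finset.image_subset_image (Finset.subset_univ J))
  · exact fun J _ J' _ h => Finset.image_injective hxs h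
  · intro J hJ
    obtain ⟨J', -, rfl⟩ := Finset.subset_image_iff.1 (Finset.mem_powerset.1 hJ)
    exact ⟨J', Finset.mem_univ _, rfl⟩
  · intro J _
    rw [W_withPoint_eq Ψ hxs hx, W_withPoint_eq Ψ hxs hx, Finset.compl_eq_univ_sdiff,
      Finset.image_sdiff _ _ hxs]
    have : (-1 : ℂ) ^ n = (-1) ^ J.card * (-1) ^ (Finset.univ \ J).card := by
      rw [← pow_add, ← Finset.compl_eq_univ_sdiff, Finset.card_add_card_compl, Fintype.card_fin]
    rw [this]
    ring

end LoopEq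

/-! ### Poles, values, difference quotients and residues of rational functions. -/

namespace LoopEq

theorem isPole_coe {f : RatFunc ℂ} {z : ℂ} : IsPole f (z : OnePoint ℂ) ↔ f.denom.eval z = 0 :=
  Iff.rfl

theorem isPole_infty {f : RatFunc ℂ} : IsPole f OnePoint.infty ↔ 0 < f.intDegree := Iff.rfl

theorem not_isPole_C (c : ℂ) (p : OnePoint ℂ) : ¬ IsPole (RatFunc.C c) p := by
  induction p using OnePoint.rec with
  | infty => simp [isPole_infty]
  | coe z => simp [isPole_coe]

theorem not_isPole_add {f g : RatFunc ℂ} {p : OnePoint ℂ} (hf : ¬ IsPole f p)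
    (hg : ¬ IsPole g p) : ¬ IsPole (f + g) p := by
  induction p using OnePoint.rec with
  | infty =>
    rw [isPole_infty, not_lt] at *
    by_cases h : f + g = 0
    · simp [h]
    by_cases h' : g = 0
    · simpa [h'] using hf
    exact (RatFunc.intDegree_add_le h' h).trans (max_le hf hg)
  | coe z =>
    rw [isPole_coe] at *
    intro h
    have := Polynomial.eval_dvd (x := z) (RatFunc.denom_add_dvd f g)
    rw [h, zero_dvd_iff, Polynomial.eval_mul] at this
    exact (mul_ne_zero hf hg) this

theorem not_isPole_mul {f g : RatFunc ℂ} {p : OnePoint ℂ} (hf : ¬ IsPole f p)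
    (hg : ¬ IsPole g p) : ¬ IsPole (f * g) p := by
  induction p using OnePoint.rec with
  | infty =>
    rw [isPole_infty, not_lt] at *
    by_cases h : f = 0
    · simp [h]
    by_cases h' : g = 0
    · simp [h']
    rw [RatFunc.intDegree_mul h h']
    omega
  | coe z =>
    rw [isPole_coe] at *
    intro h
    have := Polynomial.eval_dvd (x := z) (RatFunc.denom_mul_dvd f g)
    rw [h, zero_dvd_iff, Polynomial.eval_mul] at this
    exact (mul_ne_zero hf hg) this

/-- The rational functions that are regular at the point `p` of the Riemann sphere. -/
noncomputable def regularAt (p : OnePoint ℂ) : Subring (RatFunc ℂ) where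
  carrier := {f | ¬ IsPole f p}
  mul_mem' := not_isPole_mul
  one_mem' := by simpa using not_isPole_C 1 p
  add_mem' := not_isPole_add
  zero_mem' := by simpa using not_isPole_C 0 p
  neg_mem' := fun {f} hf => by
    have := not_isPole_mul (not_isPole_C (-1) p) hf
    simpa using this

theorem mem_regularAt {f : RatFunc ℂ} {p : OnePoint ℂ} : f ∈ regularAt p ↔ ¬ IsPole f p := Iff.rfl

theorem mem_regularAt_coe {f : RatFunc ℂ} {z : ℂ} :
    f ∈ regularAt (z : OnePoint ℂ) ↔ f.denom.eval z ≠ 0 := Iff.rfl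

theorem C_mem_regularAt (c : ℂ) (p : OnePoint ℂ) : RatFunc.C c ∈ regularAt p := not_isPole_C c p

theorem X_mem_regularAt (z : ℂ) : RatFunc.X ∈ regularAt (z : OnePoint ℂ) := by
  simp [mem_regularAt_coe]

theorem X_sub_C_ne_zero (a : ℂ) : (RatFunc.X - RatFunc.C a : RatFunc ℂ) ≠ 0 := by
  rw [← RatFunc.algebraMap_X, ← RatFunc.algebraMap_C, ← map_sub]
  exact RatFunc.algebraMap_ne_zero (Polynomial.X_sub_C_ne_zero a)

theorem evalAt_eq (f : RatFunc ℂ) (z : ℂ) : evalAt f z = f.num.eval z / f.denom.eval z := rfl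

theorem evalAt_C (c z : ℂ) : evalAt (RatFunc.C c) z = c := by simp [evalAt]

theorem evalAt_X (z : ℂ) : evalAt RatFunc.X z = z := by simp [evalAt]

theorem evalAt_add {f g : RatFunc ℂ} {z : ℂ} (hf : f ∈ regularAt z) (hg : g ∈ regularAt z) :
    evalAt (f + g) z = evalAt f z + evalAt g z :=
  RatFunc.eval_add _ _ hf hg

theorem evalAt_mul {f g : RatFunc ℂ} {z : ℂ} (hf : f ∈ regularAt z) (hg : g ∈ regularAt z) :
    evalAt (f * g) z = evalAt f z * evalAt g z :=
  RatFunc.eval_mul _ _ hf hg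

/-- The value at `z`, as a ring homomorphism on the ring of functions that are regular at `z`. -/
noncomputable def evalHom (z : ℂ) : regularAt (z : OnePoint ℂ) →+* ℂ where
  toFun f := evalAt f z
  map_one' := RatFunc.eval_one _ _
  map_zero' := RatFunc.eval_zero _ _
  map_add' f g := evalAt_add f.2 g.2
  map_mul' f g := evalAt_mul f.2 g.2

theorem evalAt_sub {f g : RatFunc ℂ} {z : ℂ} (hf : f ∈ regularAt z) (hg : g ∈ regularAt z) :
    evalAt (f - g) z = evalAt f z - evalAt g z :=
  map_sub (evalHom z) ⟨f, hf⟩ ⟨g, hg⟩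

theorem evalAt_sum {ι : Type*} {s : Finset ι} {f : ι → RatFunc ℂ} {z : ℂ}
    (hf : ∀ i ∈ s, f i ∈ regularAt z) :
    evalAt (∑ i ∈ s, f i) z = ∑ i ∈ s, evalAt (f i) z := by
  classical
  induction s using Finset.induction_on with
  | empty => simp [evalAt]
  | insert i s hi ih =>
    have hs : ∀ i ∈ s, f i ∈ regularAt z := fun j hj => hf j (Finset.mem_insert_of_mem hj)
    rw [Finset.sum_insert hi, Finset.sum_insert hi,
      evalAt_add (hf i (Finset.mem_insert_self i s)) (sum_mem hs), ih hs]

theorem differentiableAt_evalAt {f : RatFunc ℂ} {z : ℂ} (hf : f ∈ regularAt z) :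
    DifferentiableAt ℂ (evalAt f) z :=
  f.num.differentiable.differentiableAt.div f.denom.differentiable.differentiableAt hf

theorem eventually_mem_regularAt {f : RatFunc ℂ} {z : ℂ} (hf : f ∈ regularAt z) :
    ∀ᶠ w : ℂ in 𝓝 z, f ∈ regularAt w :=
  f.denom.continuous.continuousAt.eventually_ne hf

/-- The difference quotient of the rational function `f` at the finite point `a`. -/
noncomputable def diffQuot (f : RatFunc ℂ) (a : ℂ) : RatFunc ℂ :=
  (f - RatFunc.C (evalAt f a)) / (RatFunc.X - RatFunc.C a)

theorem eq_add_mul_diffQuot (f : RatFunc ℂ) (a : ℂ) :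
    f = RatFunc.C (evalAt f a) + (RatFunc.X - RatFunc.C a) * diffQuot f a := by
  rw [diffQuot, mul_div_cancel₀ _ (X_sub_C_ne_zero a)]
  ring

theorem intDegree_X_sub_C (a : ℂ) : (RatFunc.X - RatFunc.C a : RatFunc ℂ).intDegree = 1 := by
  rw [← RatFunc.algebraMap_X, ← RatFunc.algebraMap_C, ← map_sub, RatFunc.intDegree_polynomial,
    Polynomial.natDegree_X_sub_C, Nat.cast_one]

/-- The numerator of f − f(a) vanishes at a, so the division cancels and the denominator of f still
suffices; at infinity the degree only drops. -/
theorem diffQuot_mem_regularAt {f : RatFunc ℂ} {a : ℂ} (ha : f ∈ regularAt a) {p : OnePoint ℂ}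
    (hf : f ∈ regularAt p) : diffQuot f a ∈ regularAt p := by
  induction p using OnePoint.rec with
  | infty =>
    have h : f - RatFunc.C (evalAt f a) ∈ regularAt OnePoint.infty :=
      sub_mem hf (C_mem_regularAt _ _)
    rw [mem_regularAt, isPole_infty, not_lt] at h ⊢
    by_cases h0 : f - RatFunc.C (evalAt f a) = 0
    · simp [diffQuot, h0]
    · rw [diffQuot, RatFunc.intDegree_div h0 (X_sub_C_ne_zero a), intDegree_X_sub_C]
      omega
  | coe z =>
    rw [mem_regularAt_coe] at ha hf ⊢
    obtain ⟨h, hh⟩ : Polynomial.X - Polynomial.C a ∣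
        f.num - Polynomial.C (evalAt f a) * f.denom := by
      rw [Polynomial.dvd_iff_isRoot, Polynomial.IsRoot, Polynomial.eval_sub, Polynomial.eval_mul,
        Polynomial.eval_C, evalAt_eq, div_mul_cancel₀ _ ha, sub_self]
    have hd : algebraMap (Polynomial ℂ) (RatFunc ℂ) f.denom ≠ 0 :=
      RatFunc.algebraMap_ne_zero f.denom_ne_zero
    have hq : diffQuot f a = algebraMap (Polynomial ℂ) (RatFunc ℂ) h /
        algebraMap (Polynomial ℂ) (RatFunc ℂ) f.denom := by
      rw [diffQuot, div_eq_div_iff (X_sub_C_ne_zero a) hd, sub_mul]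
      nth_rewrite 1 [← RatFunc.num_div_denom f]
      rw [div_mul_cancel₀ _ hd, ← RatFunc.algebraMap_X, ← RatFunc.algebraMap_C,
        ← RatFunc.algebraMap_C, ← map_mul, ← map_sub, ← map_sub, ← map_mul, hh, mul_comm]
    rw [hq]
    intro h0
    have := Polynomial.eval_dvd (x := z) (RatFunc.denom_div_dvd h f.denom)
    rw [h0, zero_dvd_iff] at this
    exact hf this

theorem evalAt_eq_add_mul_evalAt_diffQuot {f : RatFunc ℂ} {a z : ℂ} (ha : f ∈ regularAt a)
    (hz : f ∈ regularAt z) :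
    evalAt f z = evalAt f a + (z - a) * evalAt (diffQuot f a) z := by
  conv_lhs => rw [eq_add_mul_diffQuot f a]
  have h1 := C_mem_regularAt a (z : OnePoint ℂ)
  have h2 := X_mem_regularAt z
  have h3 := diffQuot_mem_regularAt ha hz
  rw [evalAt_add (C_mem_regularAt _ _) (mul_mem (sub_mem h2 h1) h3),
    evalAt_mul (sub_mem h2 h1) h3, evalAt_sub h2 h1, evalAt_C, evalAt_C, evalAt_X]

theorem evalAt_diffQuot_of_ne {f : RatFunc ℂ} {a z : ℂ} (ha : f ∈ regularAt a)
    (hz : f ∈ regularAt z) (h : z ≠ a) :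
    evalAt (diffQuot f a) z = (z - a)⁻¹ * (evalAt f z - evalAt f a) := by
  rw [evalAt_eq_add_mul_evalAt_diffQuot ha hz, add_sub_cancel_left,
    inv_mul_cancel_left₀ (sub_ne_zero.2 h)]

theorem evalAt_diffQuot_self {f : RatFunc ℂ} {a : ℂ} (ha : f ∈ regularAt a) :
    evalAt (diffQuot f a) a = deriv (evalAt f) a := by
  have h1 : evalAt f =ᶠ[𝓝 a] fun z => evalAt f a + (z - a) * evalAt (diffQuot f a) z := by
    filter_upwards [eventually_mem_regularAt ha] with z hz
    exact evalAt_eq_add_mul_evalAt_diffQuot ha hz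
  have h2 := (((hasDerivAt_id a).sub_const a).mul
    (differentiableAt_evalAt (diffQuot_mem_regularAt ha ha)).hasDerivAt).const_add (evalAt f a)
  have h3 := (h2.congr_of_eventuallyEq h1).deriv
  rw [h3]
  simp

theorem coe_algebraMap_polynomial (q : Polynomial ℂ) :
    ((algebraMap (Polynomial ℂ) (RatFunc ℂ) q : RatFunc ℂ) : LaurentSeries ℂ) =
      ((q : PowerSeries ℂ) : LaurentSeries ℂ) :=
  (RatFunc.coe_coe q).symm

theorem residue_add (f g : RatFunc ℂ) (a : ℂ) : residue (f + g) a = residue f a + residue g a := by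
  simp [residue]

/-- The shifted denominator has nonzero constant coefficient, hence is invertible as a power series,
and the Laurent expansion has no negative powers. -/
theorem residue_eq_zero {f : RatFunc ℂ} {a : ℂ} (hf : f ∈ regularAt a) : residue f a = 0 := by
  have h1 : RatFunc.laurent a f =
      algebraMap (Polynomial ℂ) (RatFunc ℂ) (Polynomial.taylor a f.num) /
        algebraMap (Polynomial ℂ) (RatFunc ℂ) (Polynomial.taylor a f.denom) := by
    rw [← RatFunc.laurent_div, RatFunc.num_div_denom]
  have h2 : PowerSeries.constantCoeff
      ((Polynomial.taylor a f.denom : Polynomial ℂ) : PowerSeries ℂ) ≠ 0 := by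
    rw [← PowerSeries.coeff_zero_eq_constantCoeff_apply, Polynomial.coeff_coe,
      Polynomial.taylor_coeff_zero]
    exact hf
  set d : PowerSeries ℂ := ((Polynomial.taylor a f.denom : Polynomial ℂ) : PowerSeries ℂ)
  set m : PowerSeries ℂ := ((Polynomial.taylor a f.num : Polynomial ℂ) : PowerSeries ℂ)
  have h3 : ((RatFunc.laurent a f : RatFunc ℂ) : LaurentSeries ℂ) =
      ((m * d⁻¹ : PowerSeries ℂ) : LaurentSeries ℂ) := by
    have hd : ((d : PowerSeries ℂ) : LaurentSeries ℂ) ≠ 0 := by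
      intro h
      apply h2
      have : d = 0 := HahnSeries.ofPowerSeries_injective (Γ := ℤ) (by simpa using h)
      rw [this, map_zero]
    rw [h1, map_div₀, div_eq_iff]
    · rw [coe_algebraMap_polynomial, coe_algebraMap_polynomial, ← map_mul, mul_assoc,
        PowerSeries.inv_mul_cancel _ h2, mul_one]
    · rw [coe_algebraMap_polynomial]
      exact hd
  rw [residue, h3, PowerSeries.coeff_coe]
  simp

theorem residue_C_div_X_sub_C (c a : ℂ) :
    residue (RatFunc.C c / (RatFunc.X - RatFunc.C a)) a = c := by
  have h : RatFunc.laurent a (RatFunc.C c / (RatFunc.X - RatFunc.C a)) =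
      RatFunc.C c / RatFunc.X := by
    rw [map_div₀, map_sub, RatFunc.laurent_C, RatFunc.laurent_C, RatFunc.laurent_X]
    simp
  have hC : ((RatFunc.C c : RatFunc ℂ) : LaurentSeries ℂ) = HahnSeries.C c := by
    rw [← RatFunc.algebraMap_C, coe_algebraMap_polynomial]
    simp
  rw [residue, h, map_div₀, RatFunc.coe_X, hC, div_eq_mul_inv, HahnSeries.inv_single]
  simp

theorem residue_inv_mul_self {f : RatFunc ℂ} {a : ℂ} (hf : f ∈ regularAt a) :
    residue (1 / (RatFunc.X - RatFunc.C a) * f) a = evalAt f a := by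
  have h : 1 / (RatFunc.X - RatFunc.C a) * f =
      RatFunc.C (evalAt f a) / (RatFunc.X - RatFunc.C a) + diffQuot f a := by
    rw [diffQuot]
    ring
  rw [h, residue_add, residue_C_div_X_sub_C, residue_eq_zero (diffQuot_mem_regularAt hf hf),
    add_zero]

theorem one_div_X_sub_C_mem_regularAt {a b : ℂ} (hab : a ≠ b) :
    1 / (RatFunc.X - RatFunc.C b) ∈ regularAt (a : OnePoint ℂ) := by
  rw [mem_regularAt_coe]
  intro h0
  have h := RatFunc.denom_div_dvd (1 : Polynomial ℂ) (Polynomial.X - Polynomial.C b)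
  rw [map_one, map_sub, RatFunc.algebraMap_X, RatFunc.algebraMap_C] at h
  have := Polynomial.eval_dvd (x := a) h
  rw [h0, zero_dvd_iff] at this
  simp at this
  exact hab (sub_eq_zero.1 this)

theorem residue_sum_inv_mul {S : Finset ℂ} {f : ℂ → RatFunc ℂ} {a : ℂ} (ha : a ∈ S)
    (hf : ∀ b ∈ S, f b ∈ regularAt a) :
    residue (∑ b ∈ S, 1 / (RatFunc.X - RatFunc.C b) * f b) a = evalAt (f a) a := by
  rw [← Finset.add_sum_erase _ _ ha, residue_add, residue_inv_mul_self (hf a ha),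
    residue_eq_zero, add_zero]
  refine sum_mem fun b hb => mul_mem ?_ (hf b (Finset.mem_of_mem_erase hb))
  exact one_div_X_sub_C_mem_regularAt (Finset.ne_of_mem_erase hb).symm

/-! ### Partial fractions of Q, and P as difference quotients. -/

variable {D : Matrix (Fin 2) (Fin 2) (RatFunc ℂ)}

theorem trace_mul_constMat (D : Matrix (Fin 2) (Fin 2) (RatFunc ℂ))
    (N : Matrix (Fin 2) (Fin 2) ℂ) :
    (D * constMat N).trace = D 0 0 * RatFunc.C (N 0 0) + D 0 1 * RatFunc.C (N 1 0) +
      (D 1 0 * RatFunc.C (N 0 1) + D 1 1 * RatFunc.C (N 1 1)) := by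
  simp [constMat, Matrix.trace, Matrix.mul_apply, Fin.sum_univ_two]

theorem trace_mul_constMat_mem {p : OnePoint ℂ} (hD : ∀ i j, D i j ∈ regularAt p)
    (N : Matrix (Fin 2) (Fin 2) ℂ) : (D * constMat N).trace ∈ regularAt p := by
  rw [trace_mul_constMat]
  have h : ∀ i j c, D i j * RatFunc.C c ∈ regularAt p := fun i j c =>
    mul_mem (hD i j) (C_mem_regularAt c p)
  exact add_mem (add_mem (h _ _ _) (h _ _ _)) (add_mem (h _ _ _) (h _ _ _))

theorem evalAt_trace_mul_constMat {z : ℂ} (hD : ∀ i j, D i j ∈ regularAt z)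
    (N : Matrix (Fin 2) (Fin 2) ℂ) :
    evalAt (D * constMat N).trace z = (evalMat D z * N).trace := by
  rw [trace_mul_constMat]
  have h : ∀ i j c, D i j * RatFunc.C c ∈ regularAt z := fun i j c =>
    mul_mem (hD i j) (C_mem_regularAt c z)
  have h' : ∀ i j c, evalAt (D i j * RatFunc.C c) z = evalAt (D i j) z * c := fun i j c => by
    rw [evalAt_mul (hD i j) (C_mem_regularAt c z), evalAt_C]
  rw [evalAt_add (add_mem (h _ _ _) (h _ _ _)) (add_mem (h _ _ _) (h _ _ _)),
    evalAt_add (h _ _ _) (h _ _ _), evalAt_add (h _ _ _) (h _ _ _), h', h', h', h']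
  simp [evalMat, Matrix.trace, Matrix.mul_apply, Fin.sum_univ_two]

theorem trace_evalMat {z : ℂ} (hD : D.trace = 0) (hDz : ∀ i j, D i j ∈ regularAt z) :
    (evalMat D z).trace = 0 := by
  rw [Matrix.trace_fin_two] at hD ⊢
  simp only [evalMat, Matrix.map_apply]
  rw [← evalAt_add (hDz 0 0) (hDz 1 1), hD, evalAt, RatFunc.eval_zero]

theorem evalAt_det {z : ℂ} (hDz : ∀ i j, D i j ∈ regularAt z) :
    evalAt D.det z = (evalMat D z).det := by
  rw [Matrix.det_fin_two, Matrix.det_fin_two,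
    evalAt_sub (mul_mem (hDz _ _) (hDz _ _)) (mul_mem (hDz _ _) (hDz _ _)),
    evalAt_mul (hDz _ _) (hDz _ _), evalAt_mul (hDz _ _) (hDz _ _)]
  rfl

theorem path_ofFn {α R : Type*} [CommMonoid R] (k : α → α → R) {n : ℕ} (f : Fin (n + 1) → α)
    (z : α) :
    path k (f 0) (List.ofFn fun i : Fin n => f i.succ) z =
      (∏ i : Fin n, k (f i.castSucc) (f i.succ)) * k (f (Fin.last n)) z := by
  induction n with
  | zero => simp [path_nil]
  | succ n ih =>
    rw [List.ofFn_succ, path_cons, Fin.prod_univ_succ]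
    have := ih fun i => f i.succ
    rw [this, mul_assoc]
    rfl

/-- The factors of Q that involve x split as 1/(x−first) − 1/(x−last), with the closing difference
completing the open chain to a cyclic one. Regrouping by first and last letter leaves commutators.
-/
theorem Q_eq_sum (Ψ : ℂ → Matrix (Fin 2) (Fin 2) ℂ) {n : ℕ} {xs : Fin (n + 2) → ℂ}
    (hxs : Function.Injective xs) :
    Q D Ψ xs = ∑ a ∈ Finset.univ.image xs, 1 / (RatFunc.X - RatFunc.C a) *
      (D * constMat (M Ψ a * matSum (M Ψ) ((Finset.univ.image xs).erase a) a -
        matSum (M Ψ) ((Finset.univ.image xs).erase a) a * M Ψ a)).trace := by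
  set S := Finset.univ.image xs with hS
  have hcm : ∀ N, constMat N = (RatFunc.C (K := ℂ)).mapMatrix N := fun N => rfl
  have hne : S.Nonempty := ⟨xs 0, Finset.mem_image_of_mem _ (Finset.mem_univ 0)⟩
  set F : List ℂ → RatFunc ℂ := fun l =>
    RatFunc.C (cyclicChain l) * (D * constMat (l.map (M Ψ)).prod).trace with hF
  set H : List ℂ → RatFunc ℂ := fun l =>
    (1 / (RatFunc.X - RatFunc.C (l.headD 0)) - 1 / (RatFunc.X - RatFunc.C (l.getLastD 0))) * F l
    with hH
  have h1 : Q D Ψ xs = ∑ σ : Equiv.Perm (Fin (n + 2)), H (List.ofFn fun i => xs (σ i)) := by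
    rw [Q]
    refine Finset.sum_congr rfl fun σ _ => ?_
    set h := xs (σ 0)
    set la := xs (σ (Fin.last (n + 1)))
    have hla : (List.ofFn fun i => xs (σ i)).getLastD 0 = la := by
      rw [List.ofFn_succ', List.concat_eq_append, List.getLastD_concat]
    have hh : (List.ofFn fun i => xs (σ i)).headD 0 = h := by
      rw [List.ofFn_succ, List.headD_cons]
    have hcy : cyclicChain (List.ofFn fun i => xs (σ i)) =
        (∏ i : Fin (n + 1), (xs (σ i.castSucc) - xs (σ i.succ)))⁻¹ * (la - h)⁻¹ := by
      rw [List.ofFn_succ, cyclicChain, chain, path_ofFn _ (fun i => xs (σ i)),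
        Finset.prod_inv_distrib]
    have hne' : la - h ≠ 0 := by
      rw [sub_ne_zero]
      intro h0
      have := σ.injective (hxs h0)
      exact absurd this (Fin.last_pos.ne')
    have hprod : ∏ i : Fin (n + 1), (xs (σ i.castSucc) - xs (σ i.succ)) ≠ 0 := by
      refine Finset.prod_ne_zero_iff.2 fun i _ => ?_
      rw [sub_ne_zero]
      intro h0
      exact absurd (σ.injective (hxs h0)) (Fin.castSucc_lt_succ).ne
    simp only [hH, hla, hh, hF, hcy, List.map_ofFn]
    rw [show ((M Ψ) ∘ fun i => xs (σ i)) = fun i => M Ψ (xs (σ i)) from rfl, map_mul, map_inv₀,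
      map_inv₀]
    have e1 := X_sub_C_ne_zero h
    have e2 := X_sub_C_ne_zero la
    have e3 : RatFunc.C la - RatFunc.X ≠ 0 := by
      rw [← neg_sub]
      exact neg_ne_zero.2 e2
    have e4 : RatFunc.C (la - h) ≠ 0 := by rwa [Ne, map_eq_zero]
    have e5 : RatFunc.C (∏ i : Fin (n + 1), (xs (σ i.castSucc) - xs (σ i.succ))) ≠ 0 := by
      rwa [Ne, map_eq_zero]
    generalize (D * constMat (List.ofFn fun i => M Ψ (xs (σ i))).prod).trace = t
    have e6 : 1 / (RatFunc.X - RatFunc.C h) - 1 / (RatFunc.X - RatFunc.C la) =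
        RatFunc.C (la - h) * (1 / ((RatFunc.X - RatFunc.C h) * (RatFunc.C la - RatFunc.X))) := by
      rw [← neg_sub (RatFunc.C la) RatFunc.X, map_sub]
      field_simp
      ring
    rw [e6]
    field_simp
  rw [h1, sum_perm_eq_sum_orderings hxs H,
    sum_head_sub_last hne 0 (fun a => 1 / (RatFunc.X - RatFunc.C a)) F]
  refine Finset.sum_congr rfl fun a _ => ?_
  congr 1
  have h2 : ∀ m, F (a :: m) - F (m ++ [a]) = (D * constMat (chain a m a •
      (M Ψ a * (m.map (M Ψ)).prod - (m.map (M Ψ)).prod * M Ψ a))).trace := by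
    intro m
    simp only [hF, cyclicChain_concat, trace_mul_constMat]
    simp [cyclicChain]
    ring
  simp only [h2]
  rw [← Matrix.trace_sum, ← Finset.mul_sum]
  simp only [hcm]
  rw [← map_sum]
  congr 3
  simp only [matSum, Finset.mul_sum, Finset.sum_mul, ← Finset.sum_sub_distrib]
  refine Finset.sum_congr rfl fun m _ => ?_
  simp [smul_sub]

/-- The residue of Q at x_j is the value there of the trace multiplying 1/(x − x_j), so removing the
polar part leaves a difference quotient. -/
theorem P_add_two_eq (Ψ : ℂ → Matrix (Fin 2) (Fin 2) ℂ) {n : ℕ} {xs : Fin (n + 2) → ℂ}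
    (hxs : Function.Injective xs) (hD : ∀ k i j, D i j ∈ regularAt (xs k)) :
    P D Ψ (n + 2) xs = (-1) ^ (n + 2) * ∑ a ∈ Finset.univ.image xs,
      diffQuot (D * constMat (M Ψ a * matSum (M Ψ) ((Finset.univ.image xs).erase a) a -
        matSum (M Ψ) ((Finset.univ.image xs).erase a) a * M Ψ a)).trace a := by
  rw [P]
  congr 1
  have h1 : ∑ j, 1 / (RatFunc.X - RatFunc.C (xs j)) * RatFunc.C (residue (Q D Ψ xs) (xs j)) =
      ∑ a ∈ Finset.univ.image xs, 1 / (RatFunc.X - RatFunc.C a) *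
        RatFunc.C (residue (Q D Ψ xs) a) := by
    rw [Finset.sum_image hxs.injOn]
  rw [h1]
  conv_lhs => enter [1]; rw [Q_eq_sum Ψ hxs]
  rw [← Finset.sum_sub_distrib]
  refine Finset.sum_congr rfl fun a ha => ?_
  obtain ⟨k, -, rfl⟩ := Finset.mem_image.1 ha
  rw [Q_eq_sum Ψ hxs, residue_sum_inv_mul ha fun b _ => trace_mul_constMat_mem (hD k) _, diffQuot]
  ring

theorem evalAt_diffQuot_trace {a : ℂ} (hD : ∀ i j, D i j ∈ regularAt a)
    (N : Matrix (Fin 2) (Fin 2) ℂ) :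
    evalAt (diffQuot (D * constMat N).trace a) a = (derivMat D a * N).trace := by
  rw [evalAt_diffQuot_self (trace_mul_constMat_mem hD N)]
  have : evalAt (D * constMat N).trace =ᶠ[𝓝 a] fun z => (evalMat D z * N).trace := by
    have h : ∀ᶠ z : ℂ in 𝓝 a, ∀ i j, D i j ∈ regularAt z :=
      eventually_all.2 fun i => eventually_all.2 fun j => eventually_mem_regularAt (hD i j)
    filter_upwards [h] with z hz
    exact evalAt_trace_mul_constMat hz _
  rw [this.deriv_eq]
  have hd : ∀ i j, HasDerivAt (evalAt (D i j)) (derivMat D a i j) a := fun i j =>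
    (differentiableAt_evalAt (hD i j)).hasDerivAt
  refine HasDerivAt.deriv ?_
  simp only [Matrix.trace_fin_two, Matrix.mul_apply, Fin.sum_univ_two, evalMat, Matrix.map_apply]
  exact (((hd 0 0).mul_const _).add ((hd 0 1).mul_const _)).add
    (((hd 1 0).mul_const _).add ((hd 1 1).mul_const _))

/-- The first order Taylor remainder divided by (x−a)² is a twofold difference quotient, so it too
has no pole at a. -/
theorem P_one_eq (Ψ : ℂ → Matrix (Fin 2) (Fin 2) ℂ) {xs : Fin 1 → ℂ}
    (hD : ∀ i j, D i j ∈ regularAt (xs 0)) :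
    P D Ψ 1 xs =
      diffQuot (diffQuot (D * constMat (M Ψ (xs 0))).trace (xs 0)) (xs 0) := by
  set a := xs 0
  have h0 := X_sub_C_ne_zero a
  rw [diffQuot, evalAt_diffQuot_trace hD, diffQuot, evalAt_trace_mul_constMat hD, P]
  simp only [show xs 0 = a from rfl]
  field_simp
  simp only [trace_mul_constMat]
  simp [constMat, Matrix.trace_fin_two, Matrix.mul_apply, Fin.sum_univ_two]
  ring

theorem isPole_P (Ψ : ℂ → Matrix (Fin 2) (Fin 2) ℂ) {n : ℕ} {xs : Fin n → ℂ}
    (hxs : Function.Injective xs) (hD : ∀ k i j, D i j ∈ regularAt (xs k)) {p : OnePoint ℂ}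
    (hp : IsPole (P D Ψ n xs) p) : ∃ i j, IsPole (D i j) p := by
  by_contra! h
  refine absurd hp (mem_regularAt.1 ?_)
  have hDp : ∀ i j, D i j ∈ regularAt p := h
  match n, xs, hxs, hD with
  | 0, _, _, _ =>
    rw [P, Matrix.det_fin_two]
    exact sub_mem (mul_mem (hDp _ _) (hDp _ _)) (mul_mem (hDp _ _) (hDp _ _))
  | 1, xs, _, hD =>
    have h1 := trace_mul_constMat_mem (hD 0) (M Ψ (xs 0))
    rw [P_one_eq Ψ (hD 0)]
    exact diffQuot_mem_regularAt (diffQuot_mem_regularAt h1 h1)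
      (diffQuot_mem_regularAt h1 (trace_mul_constMat_mem hDp _))
  | n + 2, xs, hxs, hD =>
    rw [P_add_two_eq Ψ hxs hD]
    refine mul_mem (pow_mem (neg_mem (one_mem _)) _) (sum_mem fun a ha => ?_)
    obtain ⟨k, -, rfl⟩ := Finset.mem_image.1 ha
    exact diffQuot_mem_regularAt (trace_mul_constMat_mem (hD k) _) (trace_mul_constMat_mem hDp _)

end LoopEq

/-! ### Low orders, derivatives of W_n, and the loop equation. -/

namespace LoopEq

/-- Second order expansion by the mean value inequality for f(s) − (c/2)(s−x)² on the closed ball of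
radius |t−x|, where the derivative is at most (ε/2)|t−x|. -/
theorem tendsto_sub_div_sq {f f' : ℂ → ℂ} {c x : ℂ} (hf : ∀ᶠ t in 𝓝 x, HasDerivAt f (f' t) t)
    (hf' : HasDerivAt f' c x) (h0 : f' x = 0) :
    Tendsto (fun t => (f t - f x) / (t - x) ^ 2) (𝓝[≠] x) (𝓝 (c / 2)) := by
  rw [Metric.tendsto_nhds]
  intro ε hε
  have h1 := (hasDerivAt_iff_isLittleO.1 hf').def (half_pos hε)
  obtain ⟨r, hr, hball⟩ := Metric.eventually_nhds_iff_ball.1 (hf.and h1)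
  filter_upwards [self_mem_nhdsWithin, nhdsWithin_le_nhds (Metric.ball_mem_nhds x hr)]
    with t htx ht
  have htx' : t - x ≠ 0 := sub_ne_zero.2 htx
  have hsub : ∀ s ∈ Metric.closedBall x (dist t x), s ∈ Metric.ball x r := fun s hs =>
    Metric.mem_ball.2 (lt_of_le_of_lt (Metric.mem_closedBall.1 hs) (Metric.mem_ball.1 ht))
  have hg : ∀ s ∈ Metric.closedBall x (dist t x),
      HasDerivWithinAt (fun s => f s - c / 2 * (s - x) ^ 2) (f' s - c * (s - x))
        (Metric.closedBall x (dist t x)) s := by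
    intro s hs
    have h2 := (hball s (hsub s hs)).1
    refine (HasDerivAt.congr_deriv (h2.sub ((((hasDerivAt_id s).sub_const x).pow 2).const_mul
      (c / 2))) ?_).hasDerivWithinAt
    simp
    ring
  have hb : ∀ s ∈ Metric.closedBall x (dist t x),
      ‖f' s - c * (s - x)‖ ≤ ε / 2 * dist t x := by
    intro s hs
    have h2 := (hball s (hsub s hs)).2
    rw [h0, sub_zero, smul_eq_mul, mul_comm (s - x), ← dist_eq_norm s x] at h2
    exact h2.trans (mul_le_mul_of_nonneg_left hs (half_pos hε).le)
  have h3 := (convex_closedBall x (dist t x)).norm_image_sub_le_of_norm_hasDerivWithin_le hg hb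
    (Metric.mem_closedBall_self dist_nonneg) (Metric.mem_closedBall.2 le_rfl)
  have e : (f t - f x) / (t - x) ^ 2 - c / 2 =
      (f t - c / 2 * (t - x) ^ 2 - (f x - c / 2 * (x - x) ^ 2)) / (t - x) ^ 2 := by
    field_simp
    ring
  rw [dist_eq_norm, e, norm_div, norm_pow]
  have hpos : 0 < ‖t - x‖ := norm_pos_iff.2 htx'
  rw [div_lt_iff₀ (pow_pos hpos 2)]
  rw [dist_eq_norm] at h3
  refine h3.trans_lt ?_
  nlinarith [pow_pos hpos 2, hε]

variable {Ψ : ℂ → Matrix (Fin 2) (Fin 2) ℂ} {x : ℂ}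

theorem hasDerivAt_M_apply {E : Matrix (Fin 2) (Fin 2) ℂ} (hE : E.trace = 0)
    (hd : ∀ i j, HasDerivAt (fun w => Ψ w i j) ((E * Ψ x) i j) x) (i j : Fin 2) :
    HasDerivAt (fun w => M Ψ w i j) ((E * M Ψ x - M Ψ x * E) i j) x := by
  have h := hasDerivAt_trace_M_mul hd hE (Matrix.single j i 1)
  simpa [Matrix.trace_mul_single] using h

theorem hasDerivAt_trace_mul {A B : ℂ → Matrix (Fin 2) (Fin 2) ℂ}
    {A' B' : Matrix (Fin 2) (Fin 2) ℂ} (hA : ∀ i j, HasDerivAt (fun t => A t i j) (A' i j) x)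
    (hB : ∀ i j, HasDerivAt (fun t => B t i j) (B' i j) x) :
    HasDerivAt (fun t => (A t * B t).trace) ((A' * B x + A x * B').trace) x := by
  simp only [Matrix.trace_fin_two, Matrix.add_apply, Matrix.mul_apply, Fin.sum_univ_two]
  refine HasDerivAt.congr_deriv
    ((((hA 0 0).mul (hB 0 0)).add ((hA 0 1).mul (hB 1 0))).add
      (((hA 1 0).mul (hB 0 1)).add ((hA 1 1).mul (hB 1 1)))) ?_
  ring

theorem hasDerivAt_sub_div {g : ℂ → ℂ} {g' a : ℂ} (hg : HasDerivAt g g' a) (hx : x ≠ a) (b : ℂ) :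
    HasDerivAt (fun t => (b - g t) / (x - t))
      ((b - g a) * (x - a)⁻¹ ^ 2 - g' * (x - a)⁻¹) a := by
  have h : x - a ≠ 0 := sub_ne_zero.2 hx
  refine HasDerivAt.congr_deriv ((hg.const_sub b).div ((hasDerivAt_id a).const_sub x) h) ?_
  field_simp
  ring

theorem mul_self_of_trace_eq_zero {R : Type*} [CommRing R] {E : Matrix (Fin 2) (Fin 2) R}
    (hE : E.trace = 0) : E * E = (-E.det) • 1 := by
  rw [Matrix.trace_fin_two] at hE
  have h : E 1 1 = -E 0 0 := by linear_combination hE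
  ext i j
  fin_cases i <;> fin_cases j <;>
    simp [Matrix.mul_apply, Fin.sum_univ_two, Matrix.det_fin_two, h] <;> ring

/-- The terms in E' cancel since X is a projector; the rest follows from E² = −det E and XEX =
tr(XE)X. -/
theorem half_trace_second_derivative {X E E' : Matrix (Fin 2) (Fin 2) ℂ} (hE : E.trace = 0)
    (hX : X.trace = 1) (hXX : X * X = X) (hXEX : X * E * X = (X * E).trace • X) :
    ((E' * (X * X) + E * ((E * X - X * E) * X)).trace -
      ((E * X - X * E) * (E * X) + X * (E' * X)).trace) / 2 = -E.det - (E * X).trace ^ 2 := by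
  have hEE : (E * E * X).trace = -E.det := by
    rw [mul_self_of_trace_eq_zero hE, Matrix.smul_mul, one_mul, Matrix.trace_smul, hX,
      smul_eq_mul, mul_one]
  have hEX : (E * (X * E * X)).trace = (E * X).trace ^ 2 := by
    rw [hXEX, Matrix.mul_smul, Matrix.trace_smul, Matrix.trace_mul_comm X, smul_eq_mul, sq]
  have e1 : (X * (E' * X)).trace = (E' * X).trace := by
    rw [Matrix.trace_mul_comm, mul_assoc, hXX]
  have e2 : E * ((E * X - X * E) * X) = E * E * X - E * (X * E * X) := by
    rw [sub_mul, mul_sub, mul_assoc E X X, hXX, ← mul_assoc E E X]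
  have e3 : (E * X - X * E) * (E * X) = E * (X * E * X) - X * (E * E * X) := by
    rw [sub_mul]
    simp only [mul_assoc]
  have e4 : (X * (E * E * X)).trace = (E * E * X).trace := by
    rw [Matrix.trace_mul_comm, mul_assoc, hXX]
  rw [Matrix.trace_add, Matrix.trace_add, hXX, e1, e2, e3, Matrix.trace_sub, Matrix.trace_sub,
    e4, hEE, hEX]
  ring

variable {D : Matrix (Fin 2) (Fin 2) (RatFunc ℂ)} {U : Set ℂ}

theorem hasDerivAt_evalMat_apply (hx : ∀ i j, D i j ∈ regularAt x) (i j : Fin 2) :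
    HasDerivAt (fun t => evalMat D t i j) (derivMat D x i j) x :=
  (differentiableAt_evalAt (hx i j)).hasDerivAt

/-- The δ_{k,2} term supplies −1 = −tr M(x)², which makes W_2 a second order quotient of t ↦ tr
M(t)M(x), a function whose first derivative vanishes at x. -/
theorem W_two_eq (hdet : (Ψ x).det = 1) {t : ℂ} (htx : t ≠ x) (xs : Fin 0 → ℂ) :
    W Ψ 2 (Fin.cons x (Fin.cons t xs)) =
      ((M Ψ t * M Ψ x).trace - (M Ψ x * M Ψ x).trace) / (t - x) ^ 2 := by
  have hinj : Function.Injective (Fin.cons x (Fin.cons t xs) : Fin 2 → ℂ) := by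
    rw [Fin.cons_injective_iff, Fin.cons_injective_iff]
    refine ⟨?_, by simp, Function.injective_of_subsingleton _⟩
    rintro ⟨i, h⟩
    fin_cases i
    exact htx h
  have himg : (Finset.univ.image (Fin.cons x (Fin.cons t xs) : Fin 2 → ℂ)).erase x = {t} := by
    ext y
    simp only [Finset.mem_erase, Finset.mem_image, Finset.mem_univ, true_and,
      Fin.exists_fin_succ, Fin.cons_zero, Fin.cons_succ, Finset.mem_singleton]
    constructor
    · rintro ⟨h1, h2 | h2 | ⟨i, -⟩⟩
      · exact absurd h2.symm h1
      · exact h2.symm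
      · exact i.elim0
    · rintro rfl
      exact ⟨htx, Or.inr (Or.inl rfl)⟩
  have h := sum_full_cycles_K Ψ (Fin.cons x (Fin.cons t xs) : Fin 2 → ℂ) hinj 0
  rw [Fin.cons_zero, himg, pathSum_self, matSum, orderings_singleton, Finset.sum_singleton,
    chain_cons, chain_nil, if_pos rfl] at h
  rw [h, M_mul_self Ψ x hdet, trace_M Ψ x hdet, Matrix.trace_mul_comm (M Ψ t)]
  have h1 : t - x ≠ 0 := sub_ne_zero.2 htx
  simp only [Fin.cons_one, Fin.cons_zero, List.map_cons, List.map_nil, List.prod_cons,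
    List.prod_nil, mul_one, Matrix.mul_smul, Matrix.trace_smul, smul_eq_mul]
  rw [← neg_sub t x]
  field_simp
  ring

theorem tendsto_W_two (hU : IsOpen U) (hD : D.trace = 0)
    (hreg : ∀ z ∈ U, ∀ i j, D i j ∈ regularAt z)
    (hΨ : ∀ z ∈ U, ∀ i j, HasDerivAt (fun w => Ψ w i j) ((evalMat D z * Ψ z) i j) z)
    (hdet : ∀ z ∈ U, (Ψ z).det = 1) (hx : x ∈ U) (xs : Fin 0 → ℂ) :
    Tendsto (fun t => W Ψ 2 (Fin.cons x (Fin.cons t xs))) (𝓝[≠] x)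
      (𝓝 (-(evalMat D x).det - (evalMat D x * M Ψ x).trace ^ 2)) := by
  have hE : ∀ z ∈ U, (evalMat D z).trace = 0 := fun z hz => trace_evalMat hD (hreg z hz)
  have hM := M_mul_self Ψ x (hdet x hx)
  set E := evalMat D x with hEdef
  set X := M Ψ x with hX
  have h1 : ∀ᶠ t in 𝓝 x, HasDerivAt (fun t => (M Ψ t * X).trace)
      ((evalMat D t * (M Ψ t * X)).trace - (M Ψ t * (evalMat D t * X)).trace) t := by
    filter_upwards [hU.mem_nhds hx] with t ht
    refine HasDerivAt.congr_deriv (hasDerivAt_trace_M_mul (hΨ t ht) (hE t ht) X) ?_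
    rw [sub_mul, Matrix.trace_sub, mul_assoc, mul_assoc]
  have dM := hasDerivAt_M_apply (hE x hx) (hΨ x hx)
  have dE := hasDerivAt_evalMat_apply (hreg x hx)
  have dr : ∀ {A : ℂ → Matrix (Fin 2) (Fin 2) ℂ} {A' : Matrix (Fin 2) (Fin 2) ℂ},
      (∀ i j, HasDerivAt (fun t => A t i j) (A' i j) x) →
      ∀ i j, HasDerivAt (fun t => (A t * X) i j) ((A' * X) i j) x := by
    intro A A' hA i j
    simp only [Matrix.mul_apply, Fin.sum_univ_two]
    exact ((hA i 0).mul_const _).add ((hA i 1).mul_const _)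
  have h2 := (hasDerivAt_trace_mul dE (dr dM)).sub (hasDerivAt_trace_mul dM (dr dE))
  simp only [← hEdef, ← hX] at h2
  have h3 := tendsto_sub_div_sq h1 h2 (by
    simp only [← hEdef, ← hX]
    rw [hM, Matrix.trace_mul_comm X, mul_assoc, hM, sub_self])
  rw [half_trace_second_derivative (hE x hx) (trace_M Ψ x (hdet x hx)) hM
    (M_mul_mul_M Ψ x E)] at h3
  refine h3.congr' ?_
  filter_upwards [self_mem_nhdsWithin] with t ht
  exact (W_two_eq (hdet x hx) ht xs).symm

theorem hasDerivAt_W_one_update (hU : IsOpen U) (hD : D.trace = 0)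
    (hreg : ∀ z ∈ U, ∀ i j, D i j ∈ regularAt z)
    (hΨ : ∀ z ∈ U, ∀ i j, HasDerivAt (fun w => Ψ w i j) ((evalMat D z * Ψ z) i j) z)
    (hdet : ∀ z ∈ U, (Ψ z).det = 1) {xs : Fin 1 → ℂ} {j : Fin 1} (hj : xs j ∈ U) :
    HasDerivAt (fun t => W Ψ 1 (Function.update xs j t))
      (-(derivMat D (xs j) * M Ψ (xs j)).trace) (xs j) := by
  have hE : ∀ z ∈ U, (evalMat D z).trace = 0 := fun z hz => trace_evalMat hD (hreg z hz)
  have h := (hasDerivAt_trace_mul (hasDerivAt_evalMat_apply (hreg _ hj))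
    (hasDerivAt_M_apply (hE _ hj) (hΨ _ hj))).neg
  refine (h.congr_deriv ?_).congr_of_eventuallyEq ?_
  -- The contribution of M' drops out because tr E[E, M] = 0.
  · rw [Matrix.trace_add, mul_sub, Matrix.trace_sub, ← mul_assoc (evalMat D (xs j)) (M Ψ _),
      Matrix.trace_mul_comm (evalMat D (xs j) * M Ψ _), sub_self, add_zero]
  · filter_upwards [hU.mem_nhds hj] with t ht
    have h0 : j = 0 := Subsingleton.elim _ _
    subst h0
    exact W_one_eq (hΨ t ht) (hdet t ht) (Function.update_self _ _ _)

theorem W_add_two_update_eq {N : ℕ} {xs : Fin (N + 2) → ℂ} (hxs : Function.Injective xs)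
    (j : Fin (N + 2)) {t : ℂ} (ht : t ∉ (Finset.univ.image xs).erase (xs j)) :
    W Ψ (N + 2) (Function.update xs j t) =
      (-1) ^ (N + 1) * connected Ψ ((Finset.univ.image xs).erase (xs j)) t := by
  have ht' : ∀ k, k ≠ j → xs k ≠ t := by
    rintro k hk rfl
    exact ht (Finset.mem_erase.2 ⟨fun h => hk (hxs h),
      Finset.mem_image_of_mem _ (Finset.mem_univ k)⟩)
  have hinj : Function.Injective (Function.update xs j t) := by
    intro a b hab
    by_cases ha : a = j <;> by_cases hb : b = j
    · rw [ha, hb]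
    · subst ha
      rw [Function.update_self, Function.update_of_ne hb] at hab
      exact absurd hab.symm (ht' b hb)
    · subst hb
      rw [Function.update_self, Function.update_of_ne ha] at hab
      exact absurd hab (ht' a ha)
    · rw [Function.update_of_ne ha, Function.update_of_ne hb] at hab
      exact hxs hab
  have himg : (Finset.univ.image (Function.update xs j t)).erase t =
      (Finset.univ.image xs).erase (xs j) := by
    ext y
    simp only [Finset.mem_erase, Finset.mem_image, Finset.mem_univ, true_and]
    constructor
    · rintro ⟨h1, k, rfl⟩
      have hk : k ≠ j := by
        rintro rfl
        exact h1 (Function.update_self _ _ _)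
      rw [Function.update_of_ne hk]
      exact ⟨fun h => hk (hxs h), k, rfl⟩
    · rintro ⟨h1, k, rfl⟩
      have hk : k ≠ j := by
        rintro rfl
        exact h1 rfl
      exact ⟨ht' k hk, k, Function.update_of_ne hk _ _⟩
  have h := W_succ_eq Ψ (Nat.succ_ne_zero N) _ hinj j
  rw [Function.update_self, himg] at h
  exact h

theorem hasDerivAt_W_add_two_update {E : Matrix (Fin 2) (Fin 2) ℂ} (hE : E.trace = 0) {N : ℕ}
    {xs : Fin (N + 2) → ℂ} (hxs : Function.Injective xs) (j : Fin (N + 2))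
    (hd : ∀ i k, HasDerivAt (fun w => Ψ w i k) ((E * Ψ (xs j)) i k) (xs j)) (d : ℂ) :
    HasDerivAt (fun t => W Ψ (N + 2) (Function.update xs j t))
      ((-1) ^ (N + 1) * (((E * M Ψ (xs j) - M Ψ (xs j) * E) *
          matSum (M Ψ) ((Finset.univ.image xs).erase (xs j)) (xs j)).trace -
        ∑ l ∈ orderings ((Finset.univ.image xs).erase (xs j)),
          ((M Ψ (xs j) * (l.map (M Ψ)).prod).trace - 1) * (chain (xs j) l (xs j) *
            ((xs j - l.headD d)⁻¹ + (xs j - l.getLastD d)⁻¹)))) (xs j) := by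
  set S' := (Finset.univ.image xs).erase (xs j) with hS'
  have hne : S'.Nonempty := by
    obtain ⟨k, hk⟩ := exists_ne j
    exact ⟨xs k, Finset.mem_erase.2 ⟨fun h => hk (hxs h),
      Finset.mem_image_of_mem _ (Finset.mem_univ k)⟩⟩
  have hnot : xs j ∉ S' := Finset.notMem_erase _ _
  refine ((hasDerivAt_connected hE hd hne hnot d).const_mul _).congr_of_eventuallyEq ?_
  have hopen : IsOpen ((S' : Set ℂ)ᶜ) := S'.finite_toSet.isClosed.isOpen_compl
  filter_upwards [hopen.mem_nhds (show xs j ∈ (S' : Set ℂ)ᶜ from hnot)] with t ht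
  exact W_add_two_update_eq hxs j ht

theorem tendsto_W_cons_cons {E : Matrix (Fin 2) (Fin 2) ℂ} (hE : E.trace = 0)
    (hd : ∀ i j, HasDerivAt (fun w => Ψ w i j) ((E * Ψ x) i j) x) (hdet : (Ψ x).det = 1)
    {n : ℕ} (hn : n ≠ 0) {xs : Fin n → ℂ} (hxs : Function.Injective xs) (hx : ∀ j, x ≠ xs j)
    (hM : ∀ a ∈ Finset.univ.image xs, (M Ψ a).trace = 1) :
    Tendsto (fun t => W Ψ (n + 2) (Fin.cons x (Fin.cons t xs))) (𝓝[≠] x)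
      (𝓝 (-(-1) ^ n * (∑ J ∈ (Finset.univ.image xs).powerset,
          connected Ψ J x * connected Ψ (Finset.univ.image xs \ J) x
        + (E * matSum (M Ψ) (Finset.univ.image xs) x).trace
        - (∑ J ∈ (Finset.univ.image xs).powerset,
          ((matSum (M Ψ) J x * matSum (M Ψ) (Finset.univ.image xs \ J) x).trace
          - chainSum J x * chainSum (Finset.univ.image xs \ J) x)) / 2
        - ∑ j ∈ Finset.univ.image xs,
          connected Ψ ((Finset.univ.image xs).erase j) x * (x - j)⁻¹ ^ 2))) := by
  have hxS : x ∉ Finset.univ.image xs := by simpa using fun j h => hx j h.symm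
  have hne : (Finset.univ.image xs).Nonempty := by
    have : NeZero n := ⟨hn⟩
    exact ⟨xs 0, Finset.mem_image_of_mem _ (Finset.mem_univ 0)⟩
  refine ((tendsto_sum_pathSum_mul_pathSum hE hd hdet hne hxS hM).const_mul _).congr' ?_
  have hopen : IsOpen (((Finset.univ.image xs : Finset ℂ) : Set ℂ)ᶜ) :=
    (Finset.finite_toSet _).isClosed.isOpen_compl
  filter_upwards [self_mem_nhdsWithin, nhdsWithin_le_nhds (hopen.mem_nhds hxS)] with t htx ht
  refine (W_cons_cons_eq Ψ hn hxs hx (fun j h => ht ?_) htx).symm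
  rw [h]
  exact Finset.mem_image_of_mem _ (Finset.mem_univ j)

/-- Up to sign, u and v are the values of W_n with x and with x_j in place j, t and s the matrix
part and the weight part of its derivative, and q = 1/(x − x_j). The t terms cancel against P, and
`hT` removes v, s and T. -/
theorem sub_sum_sub_eq {ι R : Type*} [CommRing R] (S : Finset ι) (u v s t q : ι → R) (N : ℕ)
    (A B : R) {T : R} (hT : ∑ j ∈ S, (v j * q j ^ 2 - s j * q j) + T = 0) :
    -((-1) ^ (N + 2) * (A - ∑ j ∈ S, q j * t j)) - (-1) ^ (N + 2) * B -
        ∑ j ∈ S, (((-1) ^ (N + 1) * u j - (-1) ^ (N + 1) * v j) * q j ^ 2 -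
          (-1) ^ (N + 1) * (t j - s j) * q j) =
      -(-1) ^ (N + 1).succ * (B + A - T - ∑ j ∈ S, u j * q j ^ 2) := by
  have h : ∑ j ∈ S, (((-1) ^ (N + 1) * u j - (-1) ^ (N + 1) * v j) * q j ^ 2 -
      (-1) ^ (N + 1) * (t j - s j) * q j) = (-1) ^ (N + 1) * (∑ j ∈ S, u j * q j ^ 2 -
        ∑ j ∈ S, (v j * q j ^ 2 - s j * q j) - ∑ j ∈ S, q j * t j) := by
    rw [← Finset.sum_sub_distrib, ← Finset.sum_sub_distrib, Finset.mul_sum]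
    exact Finset.sum_congr rfl fun j _ => by ring
  rw [h, Nat.succ_eq_add_one]
  linear_combination (-(-1) ^ N) * hT

theorem loop_equation (hU : IsOpen U) (hD : D.trace = 0)
    (hreg : ∀ z ∈ U, ∀ i j, D i j ∈ regularAt z)
    (hΨ : ∀ z ∈ U, ∀ i j, HasDerivAt (fun w => Ψ w i j) ((evalMat D z * Ψ z) i j) z)
    (hdet : ∀ z ∈ U, (Ψ z).det = 1) (n : ℕ) (xs : Fin n → ℂ) (hxU : ∀ j, xs j ∈ U)
    (hxs : Function.Injective xs) (hx : x ∈ U) (hxj : ∀ j, x ≠ xs j) :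
    ∃ w' : Fin n → ℂ,
      (∀ j, HasDerivAt (fun t => W Ψ n (Function.update xs j t)) (w' j) (xs j)) ∧
      Tendsto (fun t => W Ψ (n + 2) (Fin.cons x (Fin.cons t xs))) (𝓝[≠] x)
        (𝓝 (-evalAt (P D Ψ n xs) x
          - ∑ J : Finset (Fin n),
              W Ψ (J.card + 1) (withPoint x xs J) * W Ψ (Jᶜ.card + 1) (withPoint x xs Jᶜ)
          - ∑ j, ((W Ψ n (Function.update xs j x) - W Ψ n (Function.update xs j (xs j)))
              * (x - xs j)⁻¹ ^ 2 - w' j * (x - xs j)⁻¹))) := by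
  have hE : ∀ z ∈ U, (evalMat D z).trace = 0 := fun z hz => trace_evalMat hD (hreg z hz)
  have hM : ∀ a ∈ Finset.univ.image xs, (M Ψ a).trace = 1 := by
    intro a ha
    obtain ⟨k, -, rfl⟩ := Finset.mem_image.1 ha
    exact trace_M Ψ _ (hdet _ (hxU k))
  have hxS : x ∉ Finset.univ.image xs := by simpa using fun j h => hxj j h.symm
  rw [sum_W_mul_W_eq Ψ hxs hxj]
  match n, xs, hxU, hxs, hxj, hM, hxS with
  | 0, xs, _, _, _, _, _ =>
    refine ⟨fun j => j.elim0, fun j => j.elim0, ?_⟩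
    convert tendsto_W_two hU hD hreg hΨ hdet hx xs using 2
    rw [P, evalAt_det (hreg x hx)]
    simp only [Finset.univ_eq_empty, Finset.image_empty, Finset.powerset_empty,
      Finset.sum_singleton, Finset.sum_empty, connected, Finset.empty_sdiff, if_true]
    rw [W_one_eq (hΨ x hx) (hdet x hx) (f := ![x]) rfl]
    ring
  | 1, xs, hxU, hxs, hxj, hM, hxS =>
    refine ⟨_, fun j => hasDerivAt_W_one_update hU hD hreg hΨ hdet (hxU j), ?_⟩
    convert tendsto_W_cons_cons (hE x hx) (hΨ x hx) (hdet x hx) one_ne_zero hxs hxj hM using 2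
    have hS : Finset.univ.image xs = {xs 0} := by simp
    set a := xs 0 with ha
    have hra := hreg a (hxU 0)
    have hrx := hreg x (hx)
    have htr : ∀ z : ℂ, (∀ i j, D i j ∈ regularAt z) →
        (D * constMat (M Ψ a)).trace ∈ regularAt z := fun z hz => trace_mul_constMat_mem hz _
    have hxa : x ≠ a := hxj 0
    have hP : evalAt (P D Ψ 1 xs) x = (x - a)⁻¹ * ((x - a)⁻¹ *
        ((evalMat D x * M Ψ a).trace - (evalMat D a * M Ψ a).trace) -
          (derivMat D a * M Ψ a).trace) := by
      rw [P_one_eq Ψ hra, evalAt_diffQuot_of_ne (diffQuot_mem_regularAt (htr a hra) (htr a hra))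
        (diffQuot_mem_regularAt (htr a hra) (htr x hrx)) hxa,
        evalAt_diffQuot_of_ne (htr a hra) (htr x hrx) hxa, evalAt_trace_mul_constMat hra,
        evalAt_trace_mul_constMat hrx, evalAt_diffQuot_trace hra]
    have hpow : ({a} : Finset ℂ).powerset = {∅, {a}} := rfl
    have hne : (∅ : Finset ℂ) ≠ {a} := (Finset.singleton_ne_empty a).symm
    have hG : matSum (M Ψ) {a} x = -(x - a)⁻¹ ^ 2 • M Ψ a := by
      rw [← chainSum_singleton]
      simp [matSum, chainSum, orderings_singleton]
    simp only [hS, hpow, Finset.sum_pair hne, matSum_empty, chainSum_empty, Finset.sdiff_empty,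
      Finset.sdiff_self, Finset.sum_singleton, Finset.erase_singleton, hP, hG]
    simp only [Finset.univ_unique, Fin.default_eq_zero, Finset.sum_singleton, connected, if_true,
      ← ha]
    rw [W_one_eq (hΨ x hx) (hdet x hx) (f := ![x]) rfl,
      W_one_eq (hΨ x hx) (hdet x hx) (f := Function.update xs 0 x) (Function.update_self _ _ _),
      W_one_eq (hΨ a (hxU 0)) (hdet a (hxU 0)) (f := Function.update xs 0 a)
        (Function.update_self _ _ _)]
    simp only [zero_mul, mul_zero, Matrix.trace_zero, sub_zero, add_zero, zero_div,
      Matrix.mul_smul, Matrix.trace_smul, smul_eq_mul]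
    ring
  | N + 2, xs, hxU, hxs, hxj, hM, hxS =>
    -- The default `0` is never read: N + 1 points remain besides x_j, so no ordering of them is
    -- empty.
    refine ⟨_, fun j => hasDerivAt_W_add_two_update (hE _ (hxU j)) hxs j (hΨ _ (hxU j)) 0, ?_⟩
    convert tendsto_W_cons_cons (hE x hx) (hΨ x hx) (hdet x hx) (Nat.succ_ne_zero _) hxs hxj hM
      using 2
    have hcard : 2 ≤ (Finset.univ.image xs).card := by
      rw [Finset.card_image_of_injective _ hxs, Finset.card_univ, Fintype.card_fin]
      omega
    have hT := sum_trace_cyclicChain (M Ψ) hcard hxS 0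
    have hP : evalAt (P D Ψ (N + 2) xs) x = (-1) ^ (N + 2) *
        ((evalMat D x * matSum (M Ψ) (Finset.univ.image xs) x).trace -
          ∑ j, (x - xs j)⁻¹ * ((evalMat D (xs j) * M Ψ (xs j) - M Ψ (xs j) * evalMat D (xs j)) *
            matSum (M Ψ) ((Finset.univ.image xs).erase (xs j)) (xs j)).trace) := by
      have hr : ∀ a ∈ Finset.univ.image xs, ∀ i j, D i j ∈ regularAt a := by
        intro a ha
        obtain ⟨k, -, rfl⟩ := Finset.mem_image.1 ha
        exact hreg _ (hxU k)
      have hc : ((-1) ^ (N + 2) : RatFunc ℂ) = RatFunc.C ((-1) ^ (N + 2)) := by simp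
      have hq : ∀ a ∈ Finset.univ.image xs, ∀ Y,
          diffQuot (D * constMat Y).trace a ∈ regularAt x := fun a ha Y =>
        diffQuot_mem_regularAt (trace_mul_constMat_mem (hr a ha) _)
          (trace_mul_constMat_mem (hreg x hx) _)
      rw [P_add_two_eq Ψ hxs fun k => hreg _ (hxU k), hc,
        evalAt_mul (C_mem_regularAt _ _) (sum_mem fun a ha => hq a ha _), evalAt_C,
        evalAt_sum fun a ha => hq a ha _, matSum_eq_sum_commutator _ hcard hxS,
        Finset.mul_sum _ _ (evalMat D x), Matrix.trace_sum, Finset.sum_image hxs.injOn,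
        Finset.sum_image hxs.injOn, ← Finset.sum_sub_distrib]
      congr 1
      refine Finset.sum_congr rfl fun j _ => ?_
      have hja : xs j ∈ Finset.univ.image xs := Finset.mem_image_of_mem _ (Finset.mem_univ j)
      rw [evalAt_diffQuot_of_ne (trace_mul_constMat_mem (hr _ hja) _)
        (trace_mul_constMat_mem (hreg x hx) _) (hxj j), evalAt_trace_mul_constMat (hr _ hja),
        evalAt_trace_mul_constMat (hreg x hx), Matrix.mul_smul, Matrix.trace_smul, smul_eq_mul,
        mul_sub]
      congr 2
      -- tr 𝒟[M, G] = tr [𝒟, M]G: the subtracted value at x_j takes the form in which M' enters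
      -- ∂W_n/∂x_j.
      rw [mul_sub, sub_mul, Matrix.trace_sub, Matrix.trace_sub, mul_assoc,
        Matrix.trace_mul_comm _ (matSum _ _ _ * _), Matrix.trace_mul_comm (M Ψ (xs j) * _),
        mul_assoc]
    have hu1 : ∀ j, W Ψ (N + 2) (Function.update xs j x) =
        (-1) ^ (N + 1) * connected Ψ ((Finset.univ.image xs).erase (xs j)) x := fun j =>
      W_add_two_update_eq hxs j fun h => hxS (Finset.mem_of_mem_erase h)
    have hu2 : ∀ j, W Ψ (N + 2) (Function.update xs j (xs j)) = (-1) ^ (N + 1) *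
        ∑ l ∈ orderings ((Finset.univ.image xs).erase (xs j)),
          chain (xs j) l (xs j) * ((M Ψ (xs j) * (l.map (M Ψ)).prod).trace - 1) := fun j => by
      rw [W_add_two_update_eq hxs j (Finset.notMem_erase _ _), connected_of_nonempty]
      rw [← Finset.card_pos, Finset.card_erase_of_mem
        (Finset.mem_image_of_mem _ (Finset.mem_univ j))]
      omega
    rw [Finset.sum_image hxs.injOn] at hT ⊢
    rw [hP]
    simp only [hu1, hu2]
    have hT' : ∀ j, ∑ m ∈ orderings ((Finset.univ.image xs).erase (xs j)),
        ((M Ψ (xs j) * (m.map (M Ψ)).prod).trace - 1) * (chain (xs j) m (xs j) *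
          ((x - xs j)⁻¹ ^ 2 - (x - xs j)⁻¹ *
            ((xs j - m.headD 0)⁻¹ + (xs j - m.getLastD 0)⁻¹))) =
        (∑ l ∈ orderings ((Finset.univ.image xs).erase (xs j)),
          chain (xs j) l (xs j) * ((M Ψ (xs j) * (l.map (M Ψ)).prod).trace - 1)) *
            (x - xs j)⁻¹ ^ 2 -
        (∑ l ∈ orderings ((Finset.univ.image xs).erase (xs j)),
          ((M Ψ (xs j) * (l.map (M Ψ)).prod).trace - 1) * (chain (xs j) l (xs j) *
            ((xs j - l.headD 0)⁻¹ + (xs j - l.getLastD 0)⁻¹))) * (x - xs j)⁻¹ := by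
      intro j
      rw [Finset.sum_mul, Finset.sum_mul, ← Finset.sum_sub_distrib]
      exact Finset.sum_congr rfl fun m _ => by ring
    simp only [hT'] at hT
    exact sub_sum_sub_eq Finset.univ _ _ _ _ _ N _ _ hT

end LoopEq

theorem mainTheorem1
    (D : Matrix (Fin 2) (Fin 2) (RatFunc ℂ)) (hD : D.trace = 0)
    (U : Set ℂ) (hU : IsOpen U)
    (hpole : ∀ z ∈ U, ∀ i j, ¬ LoopEq.IsPole (D i j) (z : OnePoint ℂ))
    (Ψ : ℂ → Matrix (Fin 2) (Fin 2) ℂ)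
    (hΨ : ∀ z ∈ U, ∀ i j,
      HasDerivAt (fun w => Ψ w i j) ((LoopEq.evalMat D z * Ψ z) i j) z)
    (hdet : ∀ z ∈ U, (Ψ z).det = 1)
    (n : ℕ) (xs : Fin n → ℂ) (hxs : ∀ j, xs j ∈ U) (hinj : Function.Injective xs) :
    -- the only poles of `P_{n+1}(x; L)` in `x`, on the Riemann sphere, are poles of `D`
    (∀ p : OnePoint ℂ, LoopEq.IsPole (LoopEq.P D Ψ n xs) p → ∃ i j, LoopEq.IsPole (D i j) p) ∧
    -- the limit that defines `W_1` exists
    (∀ z ∈ U, Tendsto (fun z' => LoopEq.K Ψ z z' - 1 / (z - z')) (𝓝[≠] z)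
      (𝓝 (LoopEq.W Ψ 1 ![z]))) ∧
    ∀ x ∈ U, (∀ j, x ≠ xs j) →
      -- the derivatives in the loop equation exist
      (∀ j, DifferentiableAt ℂ (fun t =>
        (LoopEq.W Ψ n (Function.update xs j x) - LoopEq.W Ψ n (Function.update xs j t)) / (x - t))
        (xs j)) ∧
      -- the limit that defines `W_{n+2}(x, x, L)` exists and satisfies the loop equation
      Tendsto (fun x' => LoopEq.W Ψ (n + 2) (Fin.cons x (Fin.cons x' xs))) (𝓝[≠] x)
        (𝓝 (-LoopEq.evalAt (LoopEq.P D Ψ n xs) x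
          - ∑ J : Finset (Fin n),
              LoopEq.W Ψ (J.card + 1) (LoopEq.withPoint x xs J) *
                LoopEq.W Ψ (Jᶜ.card + 1) (LoopEq.withPoint x xs Jᶜ)
          - ∑ j, deriv (fun t =>
              (LoopEq.W Ψ n (Function.update xs j x) - LoopEq.W Ψ n (Function.update xs j t))
                / (x - t)) (xs j))) := by
  have hreg : ∀ z ∈ U, ∀ i j, D i j ∈ LoopEq.regularAt (z : OnePoint ℂ) := hpole
  refine ⟨fun p hp => LoopEq.isPole_P Ψ hinj (fun k => hreg (xs k) (hxs k)) hp,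
    fun z hz => ?_, fun x hx hxj => ?_⟩
  · rw [LoopEq.W_one_eq (hΨ z hz) (hdet z hz) (f := ![z]) rfl]
    exact LoopEq.tendsto_K_sub_right (hΨ z hz) (hdet z hz)
  · obtain ⟨w', hw', hlim⟩ := LoopEq.loop_equation hU hD hreg hΨ hdet n xs hxs hinj hx hxj
    have hder := fun j =>
      LoopEq.hasDerivAt_sub_div (hw' j) (hxj j) (LoopEq.W Ψ n (Function.update xs j x))
    refine ⟨fun j => (hder j).differentiableAt, ?_⟩
    rw [Finset.sum_congr rfl fun j _ => (hder j).deriv]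
    exact hlim
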